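/- **Circuits.** Fix a finite gate set $\mathcal G$ of one- and two-qubit unitary gates. A circuit over $\mathcal G$ is a sequence of layers of gates from $\mathcal G$ in which the gates of one layer act on disjoint qubits; its depth is the number of layers, its size the number of gates. Circuits may use any number of ancillas initialised to $|0\rangle$, and their output is read on designated wires. Write $\mathrm{trdist}(\rho,\sigma)=\frac12\mathrm{tr}\sqrt{(\rho-\sigma)^\dagger(\rho-\sigma)}$. A circuit simulates $H$ for time $t$ with error $\epsilon$ if, for every pure input state $|\psi\rangle$, the state of its output wires is within trace distance $\epsilon$ of $\exp_{\mathcal T}(-i\int_0^tH(t')\,dt')|\psi\rangle$, where $\exp_{\mathcal T}$ is the time-ordered exponential. **Hard functions.** Let $s,d:\mathbb N\to\mathbb N$ with $s(n)=\Omega(n)$ and $d$ non-decreasing, and let $\hat X_n\subseteq X_n\subseteq\{0,1\}^n$ with $|\hat X_n|=2^{\Theta(n)}$. A family $f_n:\mathbb N\times\hat X_n\to X_n$ is an $(s,d)$-iterated parallel-hard function if there are maps $g_n:X_n\to X_n$ such that * $g_n$ is computed exactly by a circuit over $\mathcal G$ on $n$ qubits (no ancillas) of size at most $s(n)$; * $f_n(k,x)=g_n^{(k)}(x)$,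 the $k$-fold iterate of $g_n$ at $x$; * for every polynomial $q$ and every $K(n)=2^{o(n)}$ there are $k_0$ and a negligible $\mu$ such that, for all $n$ and all $k_0\le k\le K(n)$, every circuit $A$ over $\mathcal G$ of depth less than $d(k)$ and size at most $q(k+d(k)+n)$ satisfies $\Pr_{x\leftarrow\hat X_n}[A(x)=f_n(k,x)]\le\mu(n)$. **Theorem.** There are constants $b,c$ and a real polynomial $P$ in two variables, depending only on $\mathcal G$, such that the following holds. Let $f$ be an $(s,d)$-iterated parallel-hard function and $T$ a polynomial with coefficients in $\mathbb N$. Then there are $n$-qubit circuits $C_n$ over $\mathcal G$ (without ancillas) of size at most $s(n)$, such that $C_n^k$ maps $|x\rangle$ to $|f_n(k,x)\rangle$ up to phase for all $k\in\mathbb N$ and $x\in\hat X_n$, and, for every $n$, a time-dependent Hamiltonian $H_n$ on $n$ qubits (with times $t\ge 0$) with the following properties. 1. $H_n$ is piecewise time-independent (with finitely many pieces), and at every time it is 1-D geometrically 2-local: a sum $\sum_{l} h_l$ of Hermitian terms, $h_l$ acting only on the qubits $l,l+1$ of a line (only on $l$ if $l$ is the last qubit), with spectral norm $\|h_l\|\le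 b$. 2. $H_n$ is obtained by swap-routing $T(n)$ repetitions of $C_n$ and making each gate a time segment. That is, for each integer $0\le j<n\,s(n)\,T(n)$ it is constant on $[j,j+1)$ and $e^{-iH_n(j)}$ is the identity, a swap of two neighbouring qubits, or a gate of $\mathcal G$ on one qubit or on two neighbouring qubits; it is $0$ from time $n\,s(n)\,T(n)$ on; and for every $k\le T(n)$ the evolution up to time $k\,n\,s(n)$ equals $C_n^k$ followed by a permutation of the qubits. 3. For all nonzero polynomials $p,r$ and every polynomial $q$, all with coefficients in $\mathbb N$, the following holds for all sufficiently large $n$. Let $t\in[0,n\,s(n)\,T(n)]$ be real, $0\le\epsilon\le 1-1/p(n)$, $0<\epsilon'<1-\epsilon-1/r(n)$, and $k=\lfloor t/(n\,s(n))\rfloor$. Then every circuit over $\mathcal G$ of size at most $q(n+\lceil t\rceil+d(k))$ that simulates $H_n$ for time $t$ with error $\epsilon$ has depth at least $$d\!\left(\left\lfloor\frac{t}{n\,s(n)}\right\rfloor\right)-c\,n\,s(n)-P\bigl(\log n,\ \log\log(1/\epsilon')\bigr).$$ -/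

import Mathlib

open scoped Matrix.Norms.L2Operator MatrixOrder ComplexOrder

noncomputable section

namespace ParallelSim

/-- Computational basis labels of an `n`-qubit register. -/
abbrev Bits (n : ℕ) : Type := Fin n → Bool

/-- Operators on `n` qubits, as matrices in the computational basis. The norm is the spectral
norm. -/
abbrev Op (n : ℕ) : Type := Matrix (Bits n) (Bits n) ℂ

/-! ### Circuits -/

/-- A unitary gate on some number of qubits. -/
abbrev Gate : Type := Σ k : ℕ, Matrix.unitaryGroup (Bits k) ℂ

/-- A gate together with the distinct wires, out of `w`, it is applied to. -/
structure PlacedGate (w : ℕ) where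
  gate : Gate
  wires : Fin gate.1 ↪ Fin w

/-- The operator `gate ⊗ identity` of a placed gate. -/
def PlacedGate.toOp {w : ℕ} (p : PlacedGate w) : Op w :=
  open Classical in
  fun x y =>
    if ∀ i, i ∉ Set.range p.wires → x i = y i then
      (p.gate.2 : Op p.gate.1) (x ∘ p.wires) (y ∘ p.wires)
    else 0

/-- A circuit on `w` qubits: a sequence of layers (the first layer acts first), where the gates of
a layer act on pairwise disjoint sets of wires. -/
structure Circuit (w : ℕ) where
  layers : List (List (PlacedGate w))
  disjoint : ∀ l ∈ layers,
    l.Pairwise fun p p' => Disjoint (Set.range p.wires) (Set.range p'.wires)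

namespace Circuit

variable {w : ℕ}

/-- Number of layers. -/
def depth (C : Circuit w) : ℕ := C.layers.length

/-- Number of gates. -/
def size (C : Circuit w) : ℕ := C.layers.flatten.length

/-- All gates belong to the gate set `G`. -/
def IsOver (C : Circuit w) (G : Set Gate) : Prop := ∀ p ∈ C.layers.flatten, p.gate ∈ G

/-- The unitary operator implemented by the circuit (later gates multiply from the left). -/
def toOp (C : Circuit w) : Op w := C.layers.flatten.foldl (fun A p => p.toOp * A) 1

end Circuit

/-- A circuit on `width` qubits used as a map from `n` qubits to `n` qubits: the input is placed
on the wires `inp`, all other wires are ancillas that start in `|0⟩`, and the output is read on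
the wires `out`. -/
structure Algorithm (n : ℕ) where
  width : ℕ
  inp : Fin n ↪ Fin width
  out : Fin n ↪ Fin width
  circuit : Circuit width

namespace Algorithm

variable {n : ℕ}

/-- The initial state `|ψ⟩ ⊗ |0…0⟩`. -/
def initState (A : Algorithm n) (ψ : Bits n → ℂ) : Bits A.width → ℂ :=
  open Classical in
  fun y => if ∀ i, i ∉ Set.range A.inp → y i = false then ψ (y ∘ A.inp) else 0

/-- The state of all wires at the end. -/
def finalState (A : Algorithm n) (ψ : Bits n → ℂ) : Bits A.width → ℂ :=
  A.circuit.toOp.mulVec (A.initState ψ)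

/-- The output state on input `|ψ⟩`: the reduced density matrix of the output wires. -/
def outputDensity (A : Algorithm n) (ψ : Bits n → ℂ) : Op n :=
  open Classical in
  fun x x' => ∑ y : Bits A.width, ∑ y' : Bits A.width,
    if y ∘ A.out = x ∧ y' ∘ A.out = x' ∧ ∀ i, i ∉ Set.range A.out → y i = y' i then
      A.finalState ψ y * star (A.finalState ψ y')
    else 0

/-- The probability that on the classical input `x` the output wires are measured as `z`. -/
def outputProb (A : Algorithm n) (x z : Bits n) : ℝ :=
  open Classical in
  ∑ y : Bits A.width, if y ∘ A.out = z then ‖A.finalState (Pi.single x 1) y‖ ^ 2 else 0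

end Algorithm

/-! ### Hamiltonians and their simulation -/

/-- The trace distance `½ tr √((ρ - σ)† (ρ - σ))`. -/
def traceDist {n : ℕ} (ρ σ : Op n) : ℝ := (CFC.abs (ρ - σ)).trace.re / 2

/-- `A` acts non-trivially only on the qubits in `S`, i.e. `A = B ⊗ identity` with `B` acting on
the qubits in `S`. -/
def ActsOn {n : ℕ} (S : Set (Fin n)) (A : Op n) : Prop :=
  open Classical in
  ∃ B : Matrix (S → Bool) (S → Bool) ℂ, ∀ x y : Bits n,
    A x y = if ∀ i, i ∉ S → x i = y i then B (fun i => x i) (fun i => y i) else 0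

/-- The `k` consecutive qubits (fewer at the end of the line) that start at position `l`. -/
def window {n : ℕ} (k : ℕ) (l : Fin n) : Set (Fin n) := {i | l.1 ≤ i.1 ∧ i.1 < l.1 + k}

/-- `A` is a one-dimensional geometrically `k`-local Hamiltonian whose terms have norm at most
`b`: a sum of Hermitian terms, the `l`-th of which acts on `k` consecutive qubits from `l` on. -/
def IsGeomLocal {n : ℕ} (k : ℕ) (b : ℝ) (A : Op n) : Prop :=
  ∃ h : Fin n → Op n, A = ∑ l, h l ∧
    ∀ l, (h l).IsHermitian ∧ ‖h l‖ ≤ b ∧ ActsOn (window k l) (h l)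

/-- The time-dependent Hamiltonian `H` (on times `≥ 0`) is piecewise time-independent: there are
finitely many break points `0 = τ 0 < ⋯ < τ L`, and `H` is constant on every `[τ j, τ (j+1))` and on
`[τ L, ∞)`. -/
def IsPiecewiseConstant {n : ℕ} (H : ℝ → Op n) : Prop :=
  ∃ (L : ℕ) (τ : ℕ → ℝ), τ 0 = 0 ∧ StrictMono τ ∧
    (∀ j < L, ∀ t ∈ Set.Ico (τ j) (τ (j + 1)), H t = H (τ j)) ∧
    ∀ t, τ L ≤ t → H t = H (τ L)

/-- `U t` is the time-ordered exponential `exp_𝒯 (-i ∫₀ᵗ H)` for all `t ≥ 0`: the continuous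
solution of the Schrödinger equation `U' = -i H U`, `U 0 = 1`, with derivatives from the right (so
that break points of a piecewise constant `H` are allowed). -/
def IsTimeOrderedExp {n : ℕ} (H U : ℝ → Op n) : Prop :=
  ContinuousOn U (Set.Ici 0) ∧ U 0 = 1 ∧
    ∀ t, 0 ≤ t → HasDerivWithinAt U (-Complex.I • (H t * U t)) (Set.Ici t) t

/-- `A` implements the evolution operator `V` with error `ε`: for every initial state `|ψ⟩`, the
output is `ε`-close to `V|ψ⟩` in trace distance. -/
def Simulates {n : ℕ} (A : Algorithm n) (V : Op n) (ε : ℝ) : Prop :=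
  ∀ ψ : Bits n → ℂ, ∑ x, ‖ψ x‖ ^ 2 = 1 →
    traceDist (A.outputDensity ψ) (Matrix.vecMulVec (V.mulVec ψ) (star (V.mulVec ψ))) ≤ ε

/-- The operator that permutes the qubits: `|y⟩ ↦ |y ∘ π⟩`. -/
def permOp {n : ℕ} (π : Equiv.Perm (Fin n)) : Op n := fun x y => if x = y ∘ π then 1 else 0

/-- The Hamiltonian `H`, with evolution operators `U`, is obtained by swap-routing `T` repetitions
of the circuit `C` (of at most `s` gates over `G`, each of which takes `n` time slots) and turning
every gate of the result into a time segment of unit length. So in each time slot `[j, j + 1)` with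
`j < n * s * T` the Hamiltonian is constant and generates the identity, a swap of neighbouring
qubits, or a gate of `G` on neighbouring qubits; it vanishes afterwards; and at time `k * (n * s)`
the first `k` repetitions of `C` have been applied, up to a permutation of the qubits. -/
def IsSwapRouted {n : ℕ} (G : Set Gate) (C : Circuit n) (s T : ℕ) (H U : ℝ → Op n) : Prop :=
  (∀ j : ℕ, j < n * s * T →
    (∀ t ∈ Set.Ico (j : ℝ) (j + 1), H t = H j) ∧
    (NormedSpace.exp (-Complex.I • H j) = 1 ∨
      (∃ a b : Fin n, b.1 = a.1 + 1 ∧ NormedSpace.exp (-Complex.I • H j) = permOp (Equiv.swap a b)) ∨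
      ∃ (p : PlacedGate n) (l : Fin n), p.gate ∈ G ∧ Set.range p.wires ⊆ window 2 l ∧
        NormedSpace.exp (-Complex.I • H j) = p.toOp)) ∧
  (∀ t : ℝ, (n * s * T : ℕ) ≤ t → H t = 0) ∧
  ∀ k : ℕ, k ≤ T → ∃ π : Equiv.Perm (Fin n), U (k * (n * s) : ℕ) = permOp π * C.toOp ^ k

/-! ### Iterated parallel-hard functions -/

/-- The circuit `C` (on `n` qubits, without ancillas) computes `g` on `X`: for `x ∈ X`, measuring
`C|x⟩` gives `g x` with certainty. -/
def Computes {n : ℕ} (C : Circuit n) (X : Set (Bits n)) (g : Bits n → Bits n) : Prop :=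
  ∀ x ∈ X, ‖C.toOp (g x) x‖ ^ 2 = 1

/-- `Pr[A(x) = F(x)]` for a uniformly random `x` in `Xhat`. -/
def successProb {n : ℕ} (A : Algorithm n) (Xhat : Finset (Bits n)) (F : Bits n → Bits n) : ℝ :=
  (∑ x ∈ Xhat, A.outputProb x (F x)) / (Xhat.card : ℝ)

/-- `f` is an `(s, d)`-iterated parallel-hard function with respect to the gate set `G`. For the
security parameter `n`, the sets `Xhat n ⊆ X n` consist of `n`-bit strings and `f n` is a function
`ℕ × Xhat n → X n` (its values elsewhere are irrelevant). Size bounds `poly(k, d(k), n)` are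
written as polynomials in the sum of these natural numbers, and `k = 2 ^ o(n)` as `k ≤ K n` with
`log K(n) = o(n)`. -/
structure IsIteratedParallelHard (G : Set Gate) (s d : ℕ → ℕ) (X : (n : ℕ) → Set (Bits n))
    (Xhat : (n : ℕ) → Finset (Bits n)) (f : (n : ℕ) → ℕ → Bits n → Bits n) : Prop where
  subset : ∀ n, ∀ x ∈ Xhat n, x ∈ X n
  card : ∃ a b : ℝ, 0 < a ∧ 0 < b ∧ ∀ᶠ n : ℕ in Filter.atTop,
    (2 : ℝ) ^ (a * n) ≤ (Xhat n).card ∧ ((Xhat n).card : ℝ) ≤ 2 ^ (b * n)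
  size_lower : ∃ c : ℝ, 0 < c ∧ ∀ᶠ n : ℕ in Filter.atTop, c * n ≤ s n
  monotone : Monotone d
  iterated : ∃ g : (n : ℕ) → Bits n → Bits n,
    (∀ n, Set.MapsTo (g n) (X n) (X n)) ∧
    (∀ n, ∃ C : Circuit n, C.IsOver G ∧ C.size ≤ s n ∧ Computes C (X n) (g n)) ∧
    ∀ n k, ∀ x ∈ Xhat n, f n k x = (g n)^[k] x
  hard : ∀ (q : Polynomial ℕ) (K : ℕ → ℕ),
    (fun n => Real.log (K n)) =o[Filter.atTop] (fun n : ℕ => (n : ℝ)) →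
    ∃ (k₀ : ℕ) (μ : ℕ → ℝ),
      Asymptotics.SuperpolynomialDecay Filter.atTop (fun n : ℕ => (n : ℝ)) μ ∧
      ∀ n k : ℕ, k₀ ≤ k → k ≤ K n → ∀ A : Algorithm n, A.circuit.IsOver G →
        A.circuit.depth < d k → A.circuit.size ≤ q.eval (k + d k + n) →
        successProb A (Xhat n) (f n k) ≤ μ n

end ParallelSim

end

/-!
A circuit that simulates the swap-routed Hamiltonian up to a time `t` with error `ε` can be
completed, at the cost of `O(n s(n))` further gates, to a circuit that computes the next iterate
of the hard function with probability at least a constant times `1 - ε`. A simulation of small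
depth would therefore contradict the hardness of that iterate.

The point is the time slot in progress at time `t`. Its evolution `e^{-iτH}` is a fractional power
of a gate or swap `V`, and need not be implementable, even approximately, over the gate set, which
is not assumed to be universal or closed under inverses. But `H` is chosen as a function of `V`,
and `V` has finite spectrum, so `e^{-iτH} = ∑ r < m, c r • V V⁻ʳ`, with `m` and a bound on the
coefficients `c r` that depend on the gate set only (`exists_isBoundedGenerator`,
`exists_slot_generator`). If `φ` is the state at the beginning of the slot, the output of the
simulation has fidelity at least `1 - ε` with `∑ c r • V V⁻ʳ φ`
(`one_sub_le_fidelity_of_traceDist_le`), hence fidelity at least a constant times `1 - ε` with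
one of the `V V⁻ʳ φ` (`Simulates.exists_successProb`). Applying `Vʳ` turns this state into `V φ`,
the state at the end of the slot. The remaining slots of the current repetition consist of
at most `n s(n)` gates, up to swaps, which only relabel the output wires
(`exists_successProb_of_simulates_slotEvolution`). No gate has to be compiled approximately, so
the correction polynomial can be taken to be zero.

If the bound is not void, then `n s(n) ≤ d(k)`, and sizes polynomial in `n`, `t` and `d(k)` are
polynomial in `n`, `k` and `d(k)`. As `n s(n)` tends to infinity, this also excludes the small `k`
on which the hardness assumption says nothing (`depth_le_of_isIteratedParallelHard`).

Swap-routing itself is `exists_slots`: a gate on two qubits is preceded by the swaps that make the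
qubits neighbours, which are not undone but accumulate in a permutation of the qubits.
-/

noncomputable section

namespace ParallelSim

open scoped Matrix

/-! ### Operators acting on a subset of the wires -/

section Embed

variable {k m w : ℕ}

theorem extend_comp_embedding (f : Fin k ↪ Fin w) (u : Bits k) (z : Bits w) :
    Function.extend f u z ∘ f = u :=
  Function.extend_comp f.injective u z

theorem extend_of_notMem_range (f : Fin k ↪ Fin w) (u : Bits k) (z : Bits w) {i : Fin w}
    (hi : i ∉ Set.range f) : Function.extend f u z i = z i :=
  Function.extend_apply' u z i hi

theorem extend_comp_self (f : Fin k ↪ Fin w) {y z : Bits w}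
    (h : ∀ i, i ∉ Set.range f → z i = y i) : Function.extend f (y ∘ f) z = y := by
  funext i
  by_cases hi : i ∈ Set.range f
  · obtain ⟨j, rfl⟩ := hi
    simp [f.injective.extend_apply]
  · rw [extend_of_notMem_range f _ _ hi, h i hi]

open Classical in
/-- Summing over the bit strings that agree with `z` off the wires `f` amounts to summing over the
contents of the wires `f`. -/
theorem sum_agree_off_range {E : Type*} [AddCommMonoid E] (f : Fin k ↪ Fin w) (z : Bits w)
    (F : Bits w → E) :
    ∑ y, (if ∀ i, i ∉ Set.range f → z i = y i then F y else 0) =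
      ∑ u : Bits k, F (Function.extend f u z) := by
  rw [← Finset.sum_filter]
  symm
  refine Finset.sum_nbij (fun u => Function.extend f u z) ?_ ?_ ?_ (fun _ _ => rfl)
  · intro u _
    simp only [Finset.mem_filter, Finset.mem_univ, true_and]
    intro i hi
    rw [extend_of_notMem_range f _ _ hi]
  · exact (Function.extend_injective f.injective z).injOn
  · intro y hy
    simp only [Finset.coe_filter, Finset.mem_univ, true_and, Set.mem_ofPred_eq] at hy
    exact ⟨y ∘ f, by simp, extend_comp_self f hy⟩

open Classical in
/-- The operator `M ⊗ identity` with `M` acting on the wires `f`. -/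
def embedFun (f : Fin k ↪ Fin w) (M : Op k) : Op w := fun x y =>
  if ∀ i, i ∉ Set.range f → x i = y i then M (x ∘ f) (y ∘ f) else 0

theorem embedFun_one (f : Fin k ↪ Fin w) : embedFun f 1 = 1 := by
  classical
  ext x y
  simp only [embedFun, Matrix.one_apply]
  by_cases h : x = y
  · simp [h]
  · rw [if_neg h]
    split_ifs with h1 h2
    · exact absurd (by rw [← extend_comp_self f h1, ← h2, extend_comp_self f fun _ _ => rfl]) h
    · rfl
    · rfl

theorem embedFun_mul (f : Fin k ↪ Fin w) (A B : Op k) :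
    embedFun f (A * B) = embedFun f A * embedFun f B := by
  classical
  ext x z
  rw [Matrix.mul_apply]
  have h : ∀ y, embedFun f A x y * embedFun f B y z =
      if ∀ i, i ∉ Set.range f → x i = y i then A (x ∘ f) (y ∘ f) * embedFun f B y z else 0 := by
    intro y
    simp only [embedFun, ite_mul, zero_mul]
  simp only [h]
  rw [sum_agree_off_range f x fun y => A (x ∘ f) (y ∘ f) * embedFun f B y z]
  simp only [embedFun, extend_comp_embedding, Matrix.mul_apply]
  have h' : ∀ u, (∀ i, i ∉ Set.range f → Function.extend f u x i = z i) ↔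
      ∀ i, i ∉ Set.range f → x i = z i := fun u =>
    forall₂_congr fun i hi => by rw [extend_of_notMem_range f _ _ hi]
  simp only [h']
  split_ifs
  · rfl
  · simp

/-- `M ↦ M ⊗ identity`, where `M` acts on the wires `f`, as a homomorphism of star algebras. -/
def embed (f : Fin k ↪ Fin w) : Op k →⋆ₐ[ℂ] Op w where
  toFun := embedFun f
  map_one' := embedFun_one f
  map_mul' := embedFun_mul f
  map_zero' := by
    ext x y
    simp [embedFun]
  map_add' A B := by
    ext x y
    simp only [embedFun, Matrix.add_apply]
    split_ifs <;> simp
  commutes' c := by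
    have h : embedFun f (c • (1 : Op k)) = c • embedFun f 1 := by
      ext x y
      simp only [embedFun, Matrix.smul_apply]
      split_ifs <;> simp
    rw [Algebra.algebraMap_eq_smul_one, Algebra.algebraMap_eq_smul_one, h, embedFun_one]
  map_star' A := by
    ext x y
    simp only [embedFun, Matrix.star_apply, eq_comm (a := x _)]
    split_ifs <;> simp

open Classical in
theorem embed_apply (f : Fin k ↪ Fin w) (M : Op k) (x y : Bits w) :
    embed f M x y = if ∀ i, i ∉ Set.range f → x i = y i then M (x ∘ f) (y ∘ f) else 0 := by
  unfold embed
  simp only [StarAlgHom.coe_mk', AlgHom.coe_mk, RingHom.coe_mk, MonoidHom.coe_mk, OneHom.coe_mk]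
  unfold embedFun
  congr

theorem PlacedGate.toOp_eq_embed (p : PlacedGate w) : p.toOp = embed p.wires (p.gate.2 : Op _) := by
  classical
  ext x y
  rw [embed_apply]
  unfold PlacedGate.toOp
  congr

theorem embed_embed (f : Fin k ↪ Fin m) (g : Fin m ↪ Fin w) (M : Op k) :
    embed g (embed f M) = embed (f.trans g) M := by
  classical
  ext x y
  simp only [embed_apply]
  rw [← ite_and]
  have : ((∀ i, i ∉ Set.range g → x i = y i) ∧ ∀ i, i ∉ Set.range f → (x ∘ g) i = (y ∘ g) i) ↔
      ∀ i, i ∉ Set.range (f.trans g) → x i = y i := by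
    constructor
    · rintro ⟨h1, h2⟩ i hi
      by_cases hg : i ∈ Set.range g
      · obtain ⟨j, rfl⟩ := hg
        refine h2 j fun ⟨l, hl⟩ => hi ⟨l, by simp [hl]⟩
      · exact h1 i hg
    · intro h
      refine ⟨fun i hi => h i fun ⟨l, hl⟩ => hi ⟨f l, hl⟩, fun i hi => h _ fun ⟨l, hl⟩ => ?_⟩
      exact hi ⟨l, g.injective hl⟩
  simp only [this]
  rfl

theorem embed_mem_unitary (f : Fin k ↪ Fin w) {M : Op k} (hM : M ∈ unitary (Op k)) :
    embed f M ∈ unitary (Op w) := by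
  rw [Unitary.mem_iff] at hM ⊢
  rw [← map_star, ← map_mul, ← map_mul, hM.1, hM.2, map_one]
  exact ⟨rfl, rfl⟩

theorem PlacedGate.toOp_mem_unitary (p : PlacedGate w) : p.toOp ∈ unitary (Op w) := by
  rw [p.toOp_eq_embed]
  exact embed_mem_unitary _ p.gate.2.2

/-- An operator on the wires `f` acts on every set of wires that contains them. -/
theorem actsOn_embed (f : Fin k ↪ Fin w) {S : Set (Fin w)} (h : Set.range f ⊆ S) (M : Op k) :
    ActsOn S (embed f M) := by
  classical
  refine ⟨fun a b => if ∀ i : S, (i : Fin w) ∉ Set.range f → a i = b i then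
    M (fun j => a ⟨f j, h ⟨j, rfl⟩⟩) (fun j => b ⟨f j, h ⟨j, rfl⟩⟩) else 0, fun x y => ?_⟩
  rw [embed_apply]
  have : (∀ i, i ∉ Set.range f → x i = y i) ↔
      (∀ i, i ∉ S → x i = y i) ∧ ∀ i : S, (i : Fin w) ∉ Set.range f → x i = y i := by
    constructor
    · exact fun H => ⟨fun i hi => H i fun hf => hi (h hf), fun i hi => H i hi⟩
    · rintro ⟨h1, h2⟩ i hi
      by_cases hS : i ∈ S
      · exact h2 ⟨i, hS⟩ hi
      · exact h1 i hS
  simp only [this, ite_and]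
  rfl

end Embed

/-! ### Permutations of the qubits -/

section Perm

variable {k n : ℕ}

theorem permOp_one : permOp (1 : Equiv.Perm (Fin n)) = 1 := by
  ext x y
  simp [permOp, Matrix.one_apply]

theorem eq_comp_perm_iff (π : Equiv.Perm (Fin n)) (x y : Bits n) :
    x = y ∘ π ↔ y = x ∘ ⇑π⁻¹ := by
  constructor
  · rintro rfl
    funext i
    simp
  · rintro rfl
    funext i
    simp

theorem permOp_mul (π σ : Equiv.Perm (Fin n)) : permOp π * permOp σ = permOp (σ * π) := by
  ext x y
  simp only [permOp, Matrix.mul_apply, mul_ite, mul_one, mul_zero, Finset.sum_ite_eq',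
    Finset.mem_univ, if_true]
  exact if_congr Iff.rfl rfl rfl

theorem star_permOp (π : Equiv.Perm (Fin n)) : star (permOp π) = permOp π⁻¹ := by
  ext x y
  simp [permOp, Matrix.star_apply, eq_comp_perm_iff π y x, apply_ite]

theorem permOp_mem_unitary (π : Equiv.Perm (Fin n)) : permOp π ∈ unitary (Op n) := by
  rw [Unitary.mem_iff, star_permOp, permOp_mul, permOp_mul]
  simp [permOp_one]

theorem permOp_mul_apply (π : Equiv.Perm (Fin n)) (M : Op n) (x y : Bits n) :
    (permOp π * M) x y = M (x ∘ ⇑π⁻¹) y := by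
  simp [Matrix.mul_apply, permOp, eq_comp_perm_iff π x]

theorem mul_permOp_apply (π : Equiv.Perm (Fin n)) (M : Op n) (x y : Bits n) :
    (M * permOp π) x y = M x (y ∘ π) := by
  simp [Matrix.mul_apply, permOp]

/-- Moving an operator through a permutation of the qubits relabels its wires. -/
theorem embed_mul_permOp (f : Fin k ↪ Fin n) (π : Equiv.Perm (Fin n)) (M : Op k) :
    embed (f.trans π.symm.toEmbedding) M * permOp π = permOp π * embed f M := by
  classical
  ext x y
  rw [mul_permOp_apply, permOp_mul_apply, embed_apply, embed_apply]
  have h : (∀ i, i ∉ Set.range (f.trans π.symm.toEmbedding) → x i = (y ∘ π) i) ↔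
      ∀ i, i ∉ Set.range f → (x ∘ ⇑π⁻¹) i = y i := by
    refine π.forall_congr fun {i} => ?_
    simp [Equiv.symm_apply_eq]
  simp only [h]
  congr 1
  congr 1
  ext i
  simp

/-- The gate with its wires relabelled along an embedding; the target may have further wires. -/
def PlacedGate.relabel {w : ℕ} (p : PlacedGate n) (e : Fin n ↪ Fin w) : PlacedGate w :=
  ⟨p.gate, p.wires.trans e⟩

theorem PlacedGate.toOp_relabel {w : ℕ} (p : PlacedGate n) (e : Fin n ↪ Fin w) :
    (p.relabel e).toOp = embed e p.toOp := by
  rw [PlacedGate.toOp_eq_embed, PlacedGate.toOp_eq_embed, embed_embed]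
  rfl

theorem PlacedGate.relabel_toOp_mul_permOp (p : PlacedGate n) (π : Equiv.Perm (Fin n)) :
    (p.relabel π.symm.toEmbedding).toOp * permOp π = permOp π * p.toOp := by
  rw [PlacedGate.toOp_eq_embed, PlacedGate.toOp_eq_embed]
  exact embed_mul_permOp _ _ _

end Perm

/-! ### Products of gates -/

section Circuits

variable {n w : ℕ}

/-- The operator of a list of gates, the first of which acts first. -/
def gatesOp (L : List (PlacedGate w)) : Op w := L.foldl (fun A p => p.toOp * A) 1

theorem foldl_toOp (L : List (PlacedGate w)) (B : Op w) :
    L.foldl (fun A p => p.toOp * A) B = gatesOp L * B := by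
  induction L generalizing B with
  | nil => simp [gatesOp]
  | cons p L ih =>
    rw [gatesOp, List.foldl_cons, List.foldl_cons, ih, ih (p.toOp * 1), mul_one, mul_assoc]

@[simp]
theorem gatesOp_nil : gatesOp ([] : List (PlacedGate w)) = 1 := rfl

theorem gatesOp_cons (p : PlacedGate w) (L : List (PlacedGate w)) :
    gatesOp (p :: L) = gatesOp L * p.toOp := by
  rw [gatesOp, List.foldl_cons, foldl_toOp, mul_one]

theorem gatesOp_append (L L' : List (PlacedGate w)) :
    gatesOp (L ++ L') = gatesOp L' * gatesOp L := by
  rw [gatesOp, List.foldl_append, foldl_toOp]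
  rfl

theorem gatesOp_mem_unitary (L : List (PlacedGate w)) : gatesOp L ∈ unitary (Op w) := by
  induction L with
  | nil => exact one_mem _
  | cons p L ih =>
    rw [gatesOp_cons]
    exact mul_mem ih p.toOp_mem_unitary

theorem gatesOp_map_relabel (L : List (PlacedGate n)) (e : Fin n ↪ Fin w) :
    gatesOp (L.map fun p => p.relabel e) = embed e (gatesOp L) := by
  induction L with
  | nil => simp
  | cons p L ih => rw [List.map_cons, gatesOp_cons, gatesOp_cons, ih, p.toOp_relabel, map_mul]

theorem gatesOp_relabel_mul_permOp (L : List (PlacedGate n)) (π : Equiv.Perm (Fin n)) :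
    gatesOp (L.map fun p => p.relabel π.symm.toEmbedding) * permOp π = permOp π * gatesOp L := by
  induction L with
  | nil => simp
  | cons p L ih =>
    rw [List.map_cons, gatesOp_cons, gatesOp_cons, mul_assoc, p.relabel_toOp_mul_permOp,
      ← mul_assoc, ih, mul_assoc]

theorem Circuit.toOp_mem_unitary (C : Circuit w) : C.toOp ∈ unitary (Op w) :=
  gatesOp_mem_unitary _

end Circuits

/-! ### Unitary matrices and their columns -/

section Unitary

variable {ι : Type*} [Fintype ι] [DecidableEq ι]

theorem sum_norm_sq_mulVec_of_mem_unitary {V : Matrix ι ι ℂ} (hV : V ∈ unitary (Matrix ι ι ℂ))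
    (ψ : ι → ℂ) : ∑ x, ‖V.mulVec ψ x‖ ^ 2 = ∑ x, ‖ψ x‖ ^ 2 := by
  have key : ∀ φ : ι → ℂ, ((∑ x, ‖φ x‖ ^ 2 : ℝ) : ℂ) = star φ ⬝ᵥ φ := by
    intro φ
    push_cast
    exact Finset.sum_congr rfl fun x _ => (Complex.conj_mul' (φ x)).symm
  have h : ((∑ x, ‖V.mulVec ψ x‖ ^ 2 : ℝ) : ℂ) = ((∑ x, ‖ψ x‖ ^ 2 : ℝ) : ℂ) := by
    rw [key, key, Matrix.star_mulVec, Matrix.dotProduct_mulVec, Matrix.vecMul_vecMul,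
      ← Matrix.star_eq_conjTranspose, (Unitary.mem_iff.1 hV).1, Matrix.vecMul_one]
  exact_mod_cast h

/-- A column of a unitary matrix that has an entry of modulus one is a multiple of a basis
vector. -/
theorem mulVec_single_eq_of_norm_eq_one {V : Matrix ι ι ℂ} (hV : V ∈ unitary (Matrix ι ι ℂ))
    {x z : ι} (h : ‖V z x‖ ^ 2 = 1) : V.mulVec (Pi.single x 1) = V z x • Pi.single z 1 := by
  have hs := sum_norm_sq_mulVec_of_mem_unitary hV (Pi.single x 1)
  have h1 : ∑ y, ‖(Pi.single x (1 : ℂ) : ι → ℂ) y‖ ^ 2 = 1 := by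
    rw [Finset.sum_eq_single x] <;> simp +contextual
  rw [h1, Matrix.mulVec_single_one] at hs
  rw [Matrix.mulVec_single_one]
  ext y
  by_cases hy : y = z
  · subst hy
    simp
  · have h2 : ‖V z x‖ ^ 2 + ‖V y x‖ ^ 2 ≤ ∑ y, ‖V.col x y‖ ^ 2 := by
      rw [← Finset.add_sum_erase _ _ (Finset.mem_univ z)]
      gcongr
      · rfl
      · exact Finset.single_le_sum (f := fun y => ‖V.col x y‖ ^ 2) (fun _ _ => by positivity)
          (Finset.mem_erase.2 ⟨hy, Finset.mem_univ y⟩)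
    have h3 : ‖V y x‖ ^ 2 ≤ 0 := by linarith
    have h4 : V y x = 0 := by
      rw [← norm_eq_zero]
      exact pow_eq_zero_iff (two_ne_zero) |>.1 (le_antisymm h3 (by positivity))
    simp [hy, h4]

end Unitary

/-! ### Generators of unitaries -/

/-- The matrix `h` generates the unitary `u = e^{-ih}`, and each `e^{-iτh}` is a combination of
`u u⁻ʳ`, `r < m`, with coefficients of modulus at most `B` (where `u⁻¹` is written `star u`). -/
def IsBoundedGenerator {k : ℕ} (m : ℕ) (B : ℝ) (h u : Op k) : Prop :=
  NormedSpace.exp (-Complex.I • h) = u ∧ ∀ τ : ℝ, ∃ c : ℕ → ℂ, (∀ r, ‖c r‖ ≤ B) ∧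
    NormedSpace.exp (τ • (-Complex.I • h)) = ∑ r ∈ Finset.range m, c r • (u * star u ^ r)

theorem IsBoundedGenerator.mono {k m m' : ℕ} {B B' : ℝ} {h u : Op k}
    (H : IsBoundedGenerator m B h u) (hm : m ≤ m') (hB : B ≤ B') (hB' : 0 ≤ B') :
    IsBoundedGenerator m' B' h u := by
  refine ⟨H.1, fun τ => ?_⟩
  obtain ⟨c, hc, e⟩ := H.2 τ
  refine ⟨fun r => if r < m then c r else 0, fun r => ?_, ?_⟩
  · dsimp only
    split_ifs
    · exact (hc r).trans hB
    · simpa using hB'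
  · rw [e, ← Finset.sum_subset (Finset.range_mono hm)]
    · exact Finset.sum_congr rfl fun r hr => by simp [Finset.mem_range.1 hr]
    · intro r _ hr
      have : ¬ r < m := by simpa using hr
      simp [this]

/-- A Hermitian logarithm of a unitary matrix `u`. As the spectrum of `u` is finite, every function
of `u⁻¹` is an interpolation polynomial in `u⁻¹`; the coefficients are bounded because the
values of `z ↦ e^{-iτ arg z}` are. -/
theorem exists_isBoundedGenerator {k : ℕ} {u : Op k} (hu : u ∈ unitary (Op k)) :
    ∃ (h : Op k) (m : ℕ) (B : ℝ), h.IsHermitian ∧ IsBoundedGenerator m B h u := by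
  classical
  -- `h` is `arg` of the inverse of `u`, as the powers in the expansion have to be negative
  set v : Op k := star u with hv
  have hvu : v ∈ unitary (Op k) := Unitary.star_mem hu
  have hvn : IsStarNormal v := by
    rw [isStarNormal_iff, Commute, SemiconjBy, (Unitary.mem_iff.1 hvu).1, (Unitary.mem_iff.1 hvu).2]
  have hfin : (spectrum ℂ v).Finite := Matrix.finite_spectrum v
  have hcont : ∀ f : ℂ → ℂ, ContinuousOn f (spectrum ℂ v) := fun f => hfin.continuousOn f
  have hnorm : ∀ z ∈ spectrum ℂ v, ‖z‖ = 1 := fun z hz => spectrum.norm_eq_one_of_unitary hvu hz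
  set h : Op k := cfc (fun z => (Complex.arg z : ℂ)) v with hh
  set e : ℝ → ℂ → ℂ := fun σ z => Complex.exp ((σ • -Complex.I) * Complex.arg z) with he
  have hexp : ∀ σ : ℝ, NormedSpace.exp (σ • (-Complex.I • h)) = cfc (e σ) v := by
    intro σ
    have h1 : σ • (-Complex.I • h) = cfc (fun z => (σ • -Complex.I) * (Complex.arg z : ℂ)) v := by
      rw [cfc_const_mul _ _ _ (hcont _), ← smul_assoc]
    have h2 : IsStarNormal (cfc (fun z => (σ • -Complex.I) * (Complex.arg z : ℂ)) v) :=
      cfc_predicate _ _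
    rw [h1, ← CFC.complex_exp_eq_normedSpace_exp h2,
      ← cfc_comp' Complex.exp _ v Complex.continuous_exp.continuousOn (hcont _) hvn]
  have he1 : cfc (e 1) v = u := by
    have h1 : Set.EqOn (e 1) (fun z => star z) (spectrum ℂ v) := by
      intro z hz
      have hz1 := Complex.norm_mul_exp_arg_mul_I z
      rw [hnorm z hz, Complex.ofReal_one, one_mul] at hz1
      simp only [he, one_smul]
      conv_rhs => rw [← hz1]
      rw [Complex.star_def, ← Complex.exp_conj]
      congr 1
      simp [mul_comm]
    rw [cfc_congr h1, cfc_star_id (ha := hvn), hv, star_star]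
  set s : Finset ℂ := hfin.toFinset with hs
  have hpoly : ∀ σ : ℝ, cfc (e σ) v =
      ∑ r ∈ Finset.range (s.card + 1), (Lagrange.interpolate s id (e σ)).coeff r • v ^ r := by
    intro σ
    have h1 : Set.EqOn (e σ) (Lagrange.interpolate s id (e σ)).eval (spectrum ℂ v) := by
      intro z hz
      have := Lagrange.eval_interpolate_at_node (s := s) (v := id) (e σ) Function.injective_id.injOn
        (hfin.mem_toFinset.2 hz)
      exact this.symm
    rw [cfc_congr h1, cfc_polynomial _ _ hvn]
    refine Polynomial.aeval_eq_sum_range' (Nat.lt_succ_of_le ?_) _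
    refine Polynomial.natDegree_le_of_degree_le ?_
    exact (Lagrange.degree_interpolate_lt (e σ) Function.injective_id.injOn).le
  refine ⟨h, s.card + 1,
    ∑ r ∈ Finset.range (s.card + 1), ∑ i ∈ s, ‖(Lagrange.basis s id i).coeff r‖,
    ?_, ?_, fun τ => ?_⟩
  · rw [Matrix.IsHermitian, ← Matrix.star_eq_conjTranspose, hh, ← cfc_star]
    simp
  · rw [← one_smul ℝ (-Complex.I • h), hexp, he1]
  · refine ⟨fun r => if r < s.card + 1 then
      (Lagrange.interpolate s id (e (τ - 1))).coeff r else 0, fun r => ?_, ?_⟩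
    · dsimp only
      split_ifs with hr
      · rw [Lagrange.interpolate_apply, Polynomial.finsetSum_coeff]
        refine (norm_sum_le _ _).trans ?_
        refine le_trans (Finset.sum_le_sum fun i _ => ?_) (Finset.single_le_sum
          (f := fun r => ∑ i ∈ s, ‖(Lagrange.basis s id i).coeff r‖)
          (fun _ _ => Finset.sum_nonneg fun _ _ => norm_nonneg _) (Finset.mem_range.2 hr))
        rw [Polynomial.coeff_C_mul, norm_mul]
        have : ‖e (τ - 1) i‖ = 1 := by
          simp only [he]
          rw [Complex.norm_exp]
          simp
        rw [this, one_mul]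
      · simpa using Finset.sum_nonneg fun r _ => Finset.sum_nonneg fun i _ => norm_nonneg _
    · -- `e^{-iτh} = u e^{-i(τ-1)h}`, and the second factor is a polynomial in `u⁻¹`
      have h1 : e τ = fun z => e 1 z * e (τ - 1) z := by
        funext z
        simp only [he]
        rw [← Complex.exp_add]
        congr 1
        simp only [Complex.real_smul]
        push_cast
        ring
      rw [hexp, h1, cfc_mul _ _ _ (hcont _) (hcont _), he1, hpoly, Finset.mul_sum]
      refine Finset.sum_congr rfl fun r hr => ?_
      simp only [if_pos (Finset.mem_range.1 hr), mul_smul_comm, hv]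

/-! ### Time slots -/

section Slots

variable {n : ℕ}

/-- `V` may be the evolution operator of a time slot: the identity, a swap of neighbouring qubits,
or a gate of `G` on neighbouring qubits. -/
def IsSlotOp (G : Set Gate) (V : Op n) : Prop :=
  V = 1 ∨ (∃ a b : Fin n, b.1 = a.1 + 1 ∧ V = permOp (Equiv.swap a b)) ∨
    ∃ (p : PlacedGate n) (l : Fin n), p.gate ∈ G ∧ Set.range p.wires ⊆ window 2 l ∧ V = p.toOp

/-- The swap of two qubits, as a gate. -/
def swapGate : Gate := ⟨2, ⟨permOp (Equiv.swap 0 1), permOp_mem_unitary _⟩⟩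

/-- The embedding of a two-element register onto the wires `a` and `b`. -/
def pairWires {a b : Fin n} (h : a ≠ b) : Fin 2 ↪ Fin n :=
  ⟨![a, b], by
    intro i j hij
    fin_cases i <;> fin_cases j <;> simp_all⟩

@[simp]
theorem pairWires_zero {a b : Fin n} (h : a ≠ b) : pairWires h 0 = a := rfl

@[simp]
theorem pairWires_one {a b : Fin n} (h : a ≠ b) : pairWires h 1 = b := rfl

theorem range_pairWires {a b : Fin n} (h : a ≠ b) : Set.range (pairWires h) = {a, b} := by
  ext i
  simp [Fin.exists_fin_two, eq_comm]

theorem embed_swapGate {a b : Fin n} (h : a ≠ b) :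
    embed (pairWires h) (permOp (Equiv.swap 0 1)) = permOp (Equiv.swap a b) := by
  classical
  ext x y
  rw [embed_apply]
  simp only [range_pairWires]
  unfold permOp
  rw [← ite_and]
  refine if_congr ?_ rfl rfl
  constructor
  · rintro ⟨h1, h2⟩
    funext i
    rcases eq_or_ne i a with rfl | ha
    · simpa using congrFun h2 0
    rcases eq_or_ne i b with rfl | hb
    · simpa using congrFun h2 1
    rw [h1 i (by simp [ha, hb]), Function.comp_apply, Equiv.swap_apply_of_ne_of_ne ha hb]
  · rintro rfl
    refine ⟨fun i hi => ?_, ?_⟩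
    · simp only [Set.mem_insert_iff, Set.mem_singleton_iff, not_or] at hi
      simp [Equiv.swap_apply_of_ne_of_ne hi.1 hi.2]
    · funext i
      fin_cases i <;> simp

theorem norm_embed_le {k : ℕ} (f : Fin k ↪ Fin n) (M : Op k) : ‖embed f M‖ ≤ ‖M‖ :=
  NonUnitalStarAlgHom.norm_apply_le (embed f) M

theorem exp_embed {k : ℕ} (f : Fin k ↪ Fin n) (M : Op k) :
    NormedSpace.exp (embed f M) = embed f (NormedSpace.exp M) := by
  let : NormedAlgebra ℚ (Op k) := .restrictScalars ℚ ℂ _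
  have hc : Continuous (embed f) := (embed f).toAlgHom.toLinearMap.continuous_of_finiteDimensional
  exact (NormedSpace.map_exp (embed f) hc M).symm

theorem IsBoundedGenerator.embed {k m : ℕ} {B : ℝ} {h u : Op k} (H : IsBoundedGenerator m B h u)
    (f : Fin k ↪ Fin n) :
    IsBoundedGenerator m B (ParallelSim.embed f h) (ParallelSim.embed f u) := by
  have hr : ∀ (τ : ℝ), τ • (-Complex.I • ParallelSim.embed f h) =
      ParallelSim.embed f (τ • (-Complex.I • h)) := by
    intro τ
    rw [← Complex.coe_smul, ← Complex.coe_smul, map_smul, map_smul]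
  refine ⟨?_, fun τ => ?_⟩
  · rw [← H.1, ← exp_embed, map_smul]
  · obtain ⟨c, hc, e⟩ := H.2 τ
    refine ⟨c, hc, ?_⟩
    rw [hr, exp_embed, e, map_sum]
    exact Finset.sum_congr rfl fun r _ => by rw [map_smul, map_mul, map_pow, map_star]

theorem isGeomLocal_of_actsOn {b : ℝ} (hb : 0 ≤ b) {A : Op n} {l : Fin n} (hA : A.IsHermitian)
    (hn : ‖A‖ ≤ b) (hl : ActsOn (window 2 l) A) : IsGeomLocal 2 b A := by
  classical
  refine ⟨fun i => if i = l then A else 0, by simp, fun i => ?_⟩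
  dsimp only
  split_ifs with h
  · exact ⟨hA, hn, h ▸ hl⟩
  · exact ⟨Matrix.isHermitian_zero, by simpa using hb, ⟨0, fun x y => by simp⟩⟩

theorem isGeomLocal_zero {b : ℝ} (hb : 0 ≤ b) : IsGeomLocal 2 b (0 : Op n) :=
  ⟨fun _ => 0, by simp, fun i =>
    ⟨Matrix.isHermitian_zero, by simpa using hb, ⟨0, fun x y => by simp⟩⟩⟩

/-- Every admissible time slot has a local Hamiltonian, with bounds that depend on the gate set
only. -/
theorem exists_slot_generator {G : Set Gate} (hG : G.Finite) :
    ∃ (b : ℝ) (m : ℕ) (B : ℝ), 0 ≤ b ∧ 1 ≤ m ∧ 1 ≤ B ∧ ∀ (n : ℕ) (V : Op n), IsSlotOp G V →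
      ∃ H : Op n, IsGeomLocal 2 b H ∧ IsBoundedGenerator m B H V := by
  have hgen : ∀ u : Gate, ∃ (h : Op u.1) (m : ℕ) (B : ℝ), h.IsHermitian ∧
      IsBoundedGenerator m B h (u.2 : Op u.1) := fun u => exists_isBoundedGenerator u.2.2
  choose h m B hherm hbd using hgen
  have hG' : (insert swapGate G).Finite := hG.insert _
  obtain ⟨b₀, hb₀⟩ := (hG'.image fun u => ‖h u‖).bddAbove
  obtain ⟨m₀, hm₀⟩ := (hG'.image m).bddAbove
  obtain ⟨B₀, hB₀⟩ := (hG'.image B).bddAbove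
  have key : ∀ (n : ℕ) (u : Gate) (f : Fin u.1 ↪ Fin n) (l : Fin n), u ∈ insert swapGate G →
      Set.range f ⊆ window 2 l → ∃ H : Op n, IsGeomLocal 2 (max b₀ 0) H ∧
        IsBoundedGenerator (max m₀ 1) (max B₀ 1) H (embed f (u.2 : Op u.1)) := by
    intro n u f l hu hf
    refine ⟨embed f (h u), isGeomLocal_of_actsOn (le_max_right _ _) ?_ ?_ (actsOn_embed f hf _),
      ((hbd u).mono ?_ ?_ ?_).embed f⟩
    · have := (hherm u)
      rw [Matrix.IsHermitian, ← Matrix.star_eq_conjTranspose] at this ⊢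
      rw [← map_star, this]
    · exact (norm_embed_le f _).trans ((hb₀ ⟨u, hu, rfl⟩).trans (le_max_left _ _))
    · exact (hm₀ ⟨u, hu, rfl⟩).trans (le_max_left _ _)
    · exact (hB₀ ⟨u, hu, rfl⟩).trans (le_max_left _ _)
    · exact zero_le_one.trans (le_max_right _ _)
  refine ⟨max b₀ 0, max m₀ 1, max B₀ 1, le_max_right _ _, le_max_right _ _, le_max_right _ _,
    fun n V hV => ?_⟩
  rcases hV with rfl | ⟨a, b, hab, rfl⟩ | ⟨p, l, hp, hl, rfl⟩
  · refine ⟨0, isGeomLocal_zero (le_max_right _ _), by simp, fun τ =>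
      ⟨fun r => if r = 0 then 1 else 0, fun r => ?_, ?_⟩⟩
    · dsimp only
      split_ifs <;> simp
    · simp
  · have hne : a ≠ b := fun h => by rw [h] at hab; omega
    rw [← embed_swapGate hne]
    refine key n swapGate (pairWires hne) a (Set.mem_insert _ _) ?_
    change Set.range (pairWires hne) ⊆ _
    rw [range_pairWires]
    rintro i (rfl | rfl) <;> simp only [window, Set.mem_ofPred_eq] <;> omega
  · rw [p.toOp_eq_embed]
    exact key n p.gate p.wires l (Set.mem_insert_of_mem _ hp) hl

theorem IsSlotOp.mem_unitary {G : Set Gate} {V : Op n} (hV : IsSlotOp G V) :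
    V ∈ unitary (Op n) := by
  rcases hV with rfl | ⟨a, b, hab, rfl⟩ | ⟨p, l, hp, hl, rfl⟩
  · exact one_mem _
  · exact permOp_mem_unitary _
  · exact p.toOp_mem_unitary

/-- `V` is a product of at most `N` gates of `G`, up to a permutation of the qubits. -/
def IsGateProduct (G : Set Gate) (N : ℕ) (V : Op n) : Prop :=
  ∃ (π : Equiv.Perm (Fin n)) (L : List (PlacedGate n)), (∀ p ∈ L, p.gate ∈ G) ∧ L.length ≤ N ∧
    V = permOp π * gatesOp L

theorem isGateProduct_one (G : Set Gate) (N : ℕ) : IsGateProduct G N (1 : Op n) :=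
  ⟨1, [], by simp, by simp, by simp [permOp_one]⟩

theorem IsGateProduct.mul {G : Set Gate} {N N' : ℕ} {V V' : Op n} (hV : IsGateProduct G N V)
    (hV' : IsGateProduct G N' V') : IsGateProduct G (N + N') (V * V') := by
  obtain ⟨π, L, hL, hlen, rfl⟩ := hV
  obtain ⟨π', L', hL', hlen', rfl⟩ := hV'
  refine ⟨π' * π, L' ++ L.map fun p => p.relabel (π'⁻¹).symm.toEmbedding, ?_, ?_, ?_⟩
  · intro p hp
    rw [List.mem_append, List.mem_map] at hp
    rcases hp with hp | ⟨p, hp, rfl⟩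
    · exact hL' p hp
    · exact hL p hp
  · rw [List.length_append, List.length_map]
    omega
  · have h := gatesOp_relabel_mul_permOp L π'⁻¹
    have h1 : permOp π' * permOp π'⁻¹ = (1 : Op n) := by
      rw [permOp_mul, inv_mul_cancel, permOp_one]
    have h2 : permOp π'⁻¹ * permOp π' = (1 : Op n) := by
      rw [permOp_mul, mul_inv_cancel, permOp_one]
    have h3 : gatesOp (L.map fun p => p.relabel (π'⁻¹).symm.toEmbedding) =
        permOp π'⁻¹ * gatesOp L * permOp π' := by
      rw [← h, mul_assoc, h2, mul_one]
    rw [gatesOp_append, h3, ← permOp_mul]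
    simp only [mul_assoc]
    rw [← mul_assoc (permOp π') (permOp π'⁻¹), h1, one_mul]

theorem IsGateProduct.mono {G : Set Gate} {N N' : ℕ} {V : Op n} (hV : IsGateProduct G N V)
    (h : N ≤ N') : IsGateProduct G N' V := by
  obtain ⟨π, L, hL, hlen, e⟩ := hV
  exact ⟨π, L, hL, hlen.trans h, e⟩

theorem IsGateProduct.pow {G : Set Gate} {V : Op n} (hV : IsGateProduct G 1 V) (r : ℕ) :
    IsGateProduct G r (V ^ r) := by
  induction r with
  | zero => exact isGateProduct_one _ _
  | succ r ih => exact pow_succ V r ▸ ih.mul hV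

theorem IsSlotOp.isGateProduct {G : Set Gate} {V : Op n} (hV : IsSlotOp G V) :
    IsGateProduct G 1 V := by
  rcases hV with rfl | ⟨a, b, hab, rfl⟩ | ⟨p, l, hp, hl, rfl⟩
  · exact isGateProduct_one _ _
  · exact ⟨_, [], by simp, by simp, by rw [gatesOp_nil, mul_one]⟩
  · exact ⟨1, [p], by simpa using hp, by simp, by
      rw [permOp_one, gatesOp_cons, gatesOp_nil, one_mul, one_mul]⟩

end Slots

/-! ### Swap-routing -/

section Routing

variable {n : ℕ} {G : Set Gate}

/-- The product `v (j - 1) ⋯ v 1 v 0` of the first `j` operators of a sequence. -/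
def slotProd (v : ℕ → Op n) : ℕ → Op n
  | 0 => 1
  | j + 1 => v j * slotProd v j

theorem slotProd_congr {v v' : ℕ → Op n} {j : ℕ} (h : ∀ i < j, v i = v' i) :
    slotProd v j = slotProd v' j := by
  induction j with
  | zero => rfl
  | succ j ih =>
    rw [slotProd, slotProd, h j j.lt_succ_self, ih fun i hi => h i (hi.trans j.lt_succ_self)]

theorem slotProd_add (v : ℕ → Op n) (i j : ℕ) :
    slotProd v (i + j) = slotProd (fun l => v (i + l)) j * slotProd v i := by
  induction j with
  | zero => simp [slotProd]
  | succ j ih => rw [← add_assoc, slotProd, ih, slotProd, mul_assoc]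

/-- `V` is a product of exactly `M` slot operators. -/
def IsSlotProd (G : Set Gate) (M : ℕ) (V : Op n) : Prop :=
  ∃ v : ℕ → Op n, (∀ j, IsSlotOp G (v j)) ∧ slotProd v M = V

theorem IsSlotOp.isSlotProd {V : Op n} (hV : IsSlotOp G V) : IsSlotProd G 1 V :=
  ⟨fun _ => V, fun _ => hV, by simp [slotProd]⟩

theorem isSlotProd_one (M : ℕ) : IsSlotProd G M (1 : Op n) := by
  refine ⟨fun _ => 1, fun _ => Or.inl rfl, ?_⟩
  induction M with
  | zero => rfl
  | succ M ih => rw [slotProd, ih, one_mul]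

theorem IsSlotProd.mul {M M' : ℕ} {V V' : Op n} (hV' : IsSlotProd G M' V')
    (hV : IsSlotProd G M V) : IsSlotProd G (M + M') (V' * V) := by
  obtain ⟨v, hv, rfl⟩ := hV
  obtain ⟨v', hv', rfl⟩ := hV'
  refine ⟨fun j => if j < M then v j else v' (j - M), fun j => ?_, ?_⟩
  · dsimp only
    split_ifs
    exacts [hv j, hv' _]
  · rw [slotProd_add]
    congr 1
    · exact slotProd_congr fun i _ => by simp
    · exact slotProd_congr fun i hi => by simp [hi]

/-- A gate on two qubits at distance at most `m` takes `m` slots: swaps that bring the qubits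
together, and the gate. -/
theorem exists_isSlotProd_two (u : Matrix.unitaryGroup (Bits 2) ℂ) (hu : (⟨2, u⟩ : Gate) ∈ G)
    (m : ℕ) (f : Fin 2 ↪ Fin n) (h0 : (f 0 : ℕ) ≤ f 1 + m) (h1 : (f 1 : ℕ) ≤ f 0 + m) :
    ∃ π : Equiv.Perm (Fin n), IsSlotProd G m (permOp π * (PlacedGate.mk ⟨2, u⟩ f).toOp) := by
  induction m generalizing f with
  | zero =>
    have : f 0 = f 1 := Fin.ext (by omega)
    exact absurd (f.injective this) (by decide)
  | succ m ih =>
    by_cases hm : (f 0 : ℕ) ≤ f 1 + m ∧ (f 1 : ℕ) ≤ f 0 + m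
    · obtain ⟨π, hπ⟩ := ih f hm.1 hm.2
      refine ⟨π, ?_⟩
      have := hπ.mul (isSlotProd_one 1)
      rwa [mul_one, add_comm] at this
    obtain rfl | hm0 := Nat.eq_zero_or_pos m
    · refine ⟨1, ?_⟩
      rw [permOp_one, one_mul]
      refine IsSlotOp.isSlotProd (Or.inr (Or.inr ?_))
      rcases le_total (f 0) (f 1) with hle | hle
      · refine ⟨⟨⟨2, u⟩, f⟩, f 0, hu, ?_, rfl⟩
        rintro _ ⟨i, rfl⟩
        have : i = 0 ∨ i = 1 := by fin_cases i <;> simp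
        rw [Fin.le_iff_val_le_val] at hle
        rcases this with rfl | rfl <;> simp only [window, Set.mem_ofPred_eq] <;> omega
      · refine ⟨⟨⟨2, u⟩, f⟩, f 1, hu, ?_, rfl⟩
        rintro _ ⟨i, rfl⟩
        have : i = 0 ∨ i = 1 := by fin_cases i <;> simp
        rw [Fin.le_iff_val_le_val] at hle
        rcases this with rfl | rfl <;> simp only [window, Set.mem_ofPred_eq] <;> omega
    · -- moving the lower of the two qubits one step up reduces their distance
      have key : ∃ a b : Fin n, b.1 = a.1 + 1 ∧
          ((Equiv.swap a b (f 0) : Fin n) : ℕ) ≤ Equiv.swap a b (f 1) + m ∧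
          ((Equiv.swap a b (f 1) : Fin n) : ℕ) ≤ Equiv.swap a b (f 0) + m := by
        rcases le_total (f 0) (f 1) with hle | hle
        · rw [Fin.le_iff_val_le_val] at hle
          have hlt : (f 0 : ℕ) + 1 < n := by have := (f 1).2; omega
          refine ⟨f 0, ⟨f 0 + 1, hlt⟩, rfl, ?_⟩
          rw [Equiv.swap_apply_left, Equiv.swap_apply_of_ne_of_ne
            (fun h => by rw [h] at hm; omega)
            (fun h => by rw [Fin.ext_iff] at h; dsimp at h; omega)]
          dsimp
          omega
        · rw [Fin.le_iff_val_le_val] at hle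
          have hlt : (f 1 : ℕ) + 1 < n := by have := (f 0).2; omega
          refine ⟨f 1, ⟨f 1 + 1, hlt⟩, rfl, ?_⟩
          rw [Equiv.swap_apply_left, Equiv.swap_apply_of_ne_of_ne
            (fun h => by rw [h] at hm; omega)
            (fun h => by rw [Fin.ext_iff] at h; dsimp at h; omega)]
          dsimp
          omega
      obtain ⟨a, b, hab, h0', h1'⟩ := key
      obtain ⟨π, hπ⟩ := ih (f.trans (Equiv.swap a b).symm.toEmbedding) h0' h1'
      refine ⟨Equiv.swap a b * π, ?_⟩
      have hs : IsSlotProd G 1 (permOp (Equiv.swap a b)) :=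
        IsSlotOp.isSlotProd (Or.inr (Or.inl ⟨a, b, hab, rfl⟩))
      have h := hπ.mul hs
      have hr := PlacedGate.relabel_toOp_mul_permOp ⟨⟨2, u⟩, f⟩ (Equiv.swap a b)
      rw [PlacedGate.relabel] at hr
      rwa [mul_assoc, hr, ← mul_assoc, permOp_mul, add_comm] at h

/-- Every gate on one or two qubits takes `n` slots. -/
theorem PlacedGate.exists_isSlotProd (p : PlacedGate n) (hp : p.gate ∈ G)
    (harity : p.gate.1 = 1 ∨ p.gate.1 = 2) :
    ∃ π : Equiv.Perm (Fin n), IsSlotProd G n (permOp π * p.toOp) := by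
  obtain ⟨⟨k, u⟩, f⟩ := p
  dsimp only at f hp harity
  rcases harity with rfl | rfl
  · refine ⟨1, ?_⟩
    have hs : IsSlotProd G 1 (PlacedGate.mk ⟨1, u⟩ f).toOp := by
      refine IsSlotOp.isSlotProd (Or.inr (Or.inr ⟨⟨⟨1, u⟩, f⟩, f 0, hp, ?_, rfl⟩))
      rintro _ ⟨i, rfl⟩
      rw [Subsingleton.elim i 0]
      simp only [window, Set.mem_ofPred_eq]
      omega
    have h := hs.mul (isSlotProd_one (n - 1))
    have hn : n - 1 + 1 = n := by have := (f 0).2; omega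
    rwa [mul_one, hn, ← one_mul (PlacedGate.toOp _), ← permOp_one] at h
  · refine exists_isSlotProd_two u hp n f ?_ ?_
    · have := (f 0).2
      omega
    · have := (f 1).2
      omega

theorem exists_isSlotProd_gatesOp (harity : ∀ u ∈ G, u.1 = 1 ∨ u.1 = 2) (L : List (PlacedGate n))
    (hL : ∀ p ∈ L, p.gate ∈ G) (π : Equiv.Perm (Fin n)) :
    ∃ (π' : Equiv.Perm (Fin n)) (Q : Op n), IsSlotProd G (n * L.length) Q ∧
      Q * permOp π = permOp π' * gatesOp L := by
  induction L generalizing π with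
  | nil => exact ⟨π, 1, isSlotProd_one _, by simp⟩
  | cons p L ih =>
    obtain ⟨π₁, h₁⟩ := (p.relabel π.symm.toEmbedding).exists_isSlotProd
      (hL p List.mem_cons_self) (harity _ (hL p List.mem_cons_self))
    obtain ⟨π', Q, hQ, e⟩ := ih (fun p hp => hL p (List.mem_cons_of_mem _ hp)) (π * π₁)
    refine ⟨π', Q * (permOp π₁ * (p.relabel π.symm.toEmbedding).toOp), ?_, ?_⟩
    · rw [List.length_cons, Nat.mul_succ, add_comm]
      exact hQ.mul h₁
    · rw [mul_assoc, mul_assoc, p.relabel_toOp_mul_permOp, ← mul_assoc (permOp π₁), permOp_mul,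
        ← mul_assoc, e, gatesOp_cons, mul_assoc]

/-- Swap-routing repetitions of a circuit: an infinite sequence of slots, in which every block of
`n * s` slots carries out the circuit, up to a permutation of the qubits. -/
theorem exists_slots (harity : ∀ u ∈ G, u.1 = 1 ∨ u.1 = 2) (C : Circuit n) (hC : C.IsOver G)
    {s : ℕ} (hs : C.size ≤ s) :
    ∃ v : ℕ → Op n, (∀ j, IsSlotOp G (v j)) ∧
      ∀ k, ∃ π : Equiv.Perm (Fin n), slotProd v (k * (n * s)) = permOp π * C.toOp ^ k := by
  have hstep : ∀ π : Equiv.Perm (Fin n), ∃ (π' : Equiv.Perm (Fin n)) (v : ℕ → Op n),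
      (∀ j, IsSlotOp G (v j)) ∧ slotProd v (n * s) * permOp π = permOp π' * C.toOp := by
    intro π
    obtain ⟨π', Q, hQ, e⟩ := exists_isSlotProd_gatesOp harity C.layers.flatten hC π
    have h := hQ.mul (isSlotProd_one (n * (s - C.layers.flatten.length)))
    have hlen : n * (s - C.layers.flatten.length) + n * C.layers.flatten.length = n * s := by
      rw [← mul_add, Nat.sub_add_cancel (show C.layers.flatten.length ≤ s from hs)]
    rw [hlen, mul_one] at h
    obtain ⟨v, hv, rfl⟩ := h
    exact ⟨π', v, hv, e⟩
  choose nxt w hw hprod using hstep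
  set σ : ℕ → Equiv.Perm (Fin n) := fun k => nxt^[k] 1 with hσ
  refine ⟨fun j => w (σ (j / (n * s))) (j % (n * s)), fun j => hw _ _, fun k => ⟨σ k, ?_⟩⟩
  induction k with
  | zero => simp [slotProd, hσ, permOp_one]
  | succ k ih =>
    have hblock : slotProd (fun l => w (σ ((k * (n * s) + l) / (n * s)))
        ((k * (n * s) + l) % (n * s))) (n * s) = slotProd (w (σ k)) (n * s) := by
      refine slotProd_congr fun l hl => ?_
      have h1 : (k * (n * s) + l) / (n * s) = k := by
        rw [mul_comm, Nat.mul_add_div (by omega), Nat.div_eq_of_lt hl, add_zero]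
      have h2 : (k * (n * s) + l) % (n * s) = l := by
        rw [mul_comm, Nat.mul_add_mod, Nat.mod_eq_of_lt hl]
      rw [h1, h2]
    rw [Nat.succ_mul, slotProd_add, hblock, ih, ← mul_assoc, hprod, mul_assoc, ← pow_succ']
    congr 2
    exact (Function.iterate_succ_apply' nxt k 1).symm

end Routing

/-! ### The time evolution of a sequence of slots -/

section Evolution

variable {n : ℕ} (X : ℕ → Op n) (N : ℕ)

/-- The Hamiltonian that is `X j` on `[j, j + 1)` for `j < N` and `0` from time `N` on. -/
def slotHamiltonian (t : ℝ) : Op n := if ⌊t⌋₊ < N then X ⌊t⌋₊ else 0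

/-- The evolution operators of `slotHamiltonian X N`: the `j`-th factor is constant outside
`[j, j + 1]`. -/
def slotEvolution (t : ℝ) : Op n :=
  slotProd (fun j => NormedSpace.exp (max 0 (min 1 (t - j)) • (-Complex.I • X j))) N

variable {X N}

theorem slotHamiltonian_eq {j : ℕ} (hj : j < N) {t : ℝ} (ht : t ∈ Set.Ico (j : ℝ) (j + 1)) :
    slotHamiltonian X N t = X j := by
  have : ⌊t⌋₊ = j := (Nat.floor_eq_iff ((Nat.cast_nonneg j).trans ht.1)).2 ht
  rw [slotHamiltonian, this, if_pos hj]

theorem slotHamiltonian_eq_zero {t : ℝ} (ht : (N : ℝ) ≤ t) : slotHamiltonian X N t = 0 := by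
  rw [slotHamiltonian, if_neg (not_lt.2 (Nat.le_floor ht))]

theorem isPiecewiseConstant_slotHamiltonian : IsPiecewiseConstant (slotHamiltonian X N) := by
  refine ⟨N, fun j => j, Nat.cast_zero, Nat.strictMono_cast, fun j hj t ht => ?_, fun t ht => ?_⟩
  · dsimp only at ht ⊢
    rw [Nat.cast_succ] at ht
    rw [slotHamiltonian_eq hj ht, slotHamiltonian_eq hj ⟨le_rfl, lt_add_one _⟩]
  · rw [slotHamiltonian_eq_zero ht, slotHamiltonian_eq_zero le_rfl]

theorem exp_continuous_op : Continuous (NormedSpace.exp : Op n → Op n) :=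
  let : NormedAlgebra ℚ (Op n) := .restrictScalars ℚ ℂ _
  NormedSpace.exp_continuous

theorem continuous_slotEvolution : Continuous (slotEvolution X N) := by
  unfold slotEvolution
  induction N with
  | zero => exact continuous_const
  | succ N ih =>
    refine Continuous.mul (exp_continuous_op.comp ?_) ih
    have h : Continuous fun t : ℝ => max 0 (min 1 (t - (N : ℝ))) := by fun_prop
    exact h.smul continuous_const

theorem slotProd_of_le {t : ℝ} {j : ℕ} (ht : (j : ℝ) ≤ t) :
    slotProd (fun j => NormedSpace.exp (max 0 (min 1 (t - j)) • (-Complex.I • X j))) j =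
      slotProd (fun j => NormedSpace.exp (-Complex.I • X j)) j := by
  refine slotProd_congr fun i hi => ?_
  have h1 : (i : ℝ) + 1 ≤ j := by exact_mod_cast hi
  rw [min_eq_left (by linarith), max_eq_right zero_le_one, one_smul]

theorem slotEvolution_of_le {t : ℝ} (ht : (N : ℝ) ≤ t) :
    slotEvolution X N t = slotProd (fun j => NormedSpace.exp (-Complex.I • X j)) N :=
  slotProd_of_le ht

theorem slotEvolution_of_mem_Icc {j : ℕ} (hj : j < N) {t : ℝ}
    (ht : t ∈ Set.Icc (j : ℝ) (j + 1)) :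
    slotEvolution X N t = NormedSpace.exp ((t - j) • (-Complex.I • X j)) *
      slotProd (fun j => NormedSpace.exp (-Complex.I • X j)) j := by
  obtain ⟨l, rfl⟩ := Nat.exists_eq_add_of_le (Nat.succ_le_of_lt hj)
  rw [slotEvolution, slotProd_add]
  have h1 : ∀ (v : ℕ → Op n) (l : ℕ), (∀ i, v i = 1) → slotProd v l = 1 := by
    intro v l hv
    induction l with
    | zero => rfl
    | succ l ih => rw [slotProd, ih, hv, one_mul]
  rw [h1 _ l fun i => ?_, one_mul, slotProd, slotProd_of_le ht.1, min_eq_right (by linarith [ht.2]),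
    max_eq_right (by linarith [ht.1])]
  have h2 : t - ((j.succ + i : ℕ) : ℝ) ≤ 0 := by
    push_cast
    have := Nat.cast_nonneg (α := ℝ) i
    linarith [ht.2]
  rw [max_eq_left ((min_le_right _ _).trans h2), zero_smul, NormedSpace.exp_zero]

theorem slotEvolution_natCast {j : ℕ} (hj : j ≤ N) :
    slotEvolution X N j = slotProd (fun j => NormedSpace.exp (-Complex.I • X j)) j := by
  rcases hj.lt_or_eq with hj | rfl
  · rw [slotEvolution_of_mem_Icc hj ⟨le_rfl, by linarith⟩, sub_self, zero_smul,
      NormedSpace.exp_zero, one_mul]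
  · exact slotEvolution_of_le le_rfl

theorem isTimeOrderedExp_slotEvolution :
    IsTimeOrderedExp (slotHamiltonian X N) (slotEvolution X N) := by
  refine ⟨continuous_slotEvolution.continuousOn, ?_, fun t ht => ?_⟩
  · have := slotEvolution_natCast (X := X) (Nat.zero_le N)
    rwa [Nat.cast_zero] at this
  · rcases lt_or_ge t N with hN | hN
    · have hj : ⌊t⌋₊ < N := (Nat.floor_lt ht).2 hN
      have hmem : t ∈ Set.Ico (⌊t⌋₊ : ℝ) (⌊t⌋₊ + 1) := ⟨Nat.floor_le ht, Nat.lt_floor_add_one t⟩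
      set j := ⌊t⌋₊
      rw [slotHamiltonian_eq hj hmem, slotEvolution_of_mem_Icc hj ⟨hmem.1, hmem.2.le⟩]
      have hd := ((hasDerivAt_exp_smul_const' (𝕂 := ℝ) (-Complex.I • X j) (t - j)).scomp t
        ((hasDerivAt_id t).sub_const (j : ℝ))).mul_const
          (slotProd (fun j => NormedSpace.exp (-Complex.I • X j)) j)
      rw [one_smul, mul_assoc, smul_mul_assoc] at hd
      refine hd.hasDerivWithinAt.congr_of_eventuallyEq ?_ ?_
      · filter_upwards [Icc_mem_nhdsGE hmem.2] with y hy
        exact slotEvolution_of_mem_Icc hj ⟨hmem.1.trans hy.1, hy.2⟩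
      · exact slotEvolution_of_mem_Icc hj ⟨hmem.1, hmem.2.le⟩
    · rw [slotHamiltonian_eq_zero hN, zero_mul, smul_zero]
      refine (hasDerivWithinAt_const t _
        (slotProd (fun j => NormedSpace.exp (-Complex.I • X j)) N)).congr ?_ ?_
      · exact fun y hy => slotEvolution_of_le (hN.trans hy)
      · exact slotEvolution_of_le hN

end Evolution

/-! ### Reduced states -/

section Slice

variable {n w : ℕ}

theorem extend_extend (e : Fin n ↪ Fin w) (x x' : Bits n) (y : Bits w) :
    Function.extend e x' (Function.extend e x y) = Function.extend e x' y := by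
  funext i
  by_cases hi : i ∈ Set.range e
  · obtain ⟨j, rfl⟩ := hi
    rw [e.injective.extend_apply, e.injective.extend_apply]
  · rw [extend_of_notMem_range e _ _ hi, extend_of_notMem_range e _ _ hi,
      extend_of_notMem_range e _ _ hi]

theorem extend_eq_self (e : Fin n ↪ Fin w) (y : Bits w) : Function.extend e (y ∘ e) y = y :=
  extend_comp_self e fun _ _ => rfl

open Classical in
/-- The bit strings with prescribed contents `x` of the wires `e` are parametrized by those
with zeros there. -/
theorem sum_fiber {E : Type*} [AddCommMonoid E] (e : Fin n ↪ Fin w) (x : Bits n)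
    (F : Bits w → E) :
    ∑ y, (if y ∘ e = x then F y else 0) =
      ∑ y, if y ∘ e = fun _ => false then F (Function.extend e x y) else 0 := by
  rw [← Finset.sum_filter, ← Finset.sum_filter]
  refine Finset.sum_nbij' (fun y => Function.extend e (fun _ => false) y)
    (fun y => Function.extend e x y) ?_ ?_ ?_ ?_ ?_
  · intro y _
    simpa using extend_comp_embedding e _ y
  · intro y _
    simpa using extend_comp_embedding e _ y
  · intro y hy
    simp only [Finset.mem_filter, Finset.mem_univ, true_and] at hy
    rw [extend_extend, ← hy, extend_eq_self]
  · intro y hy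
    simp only [Finset.mem_filter, Finset.mem_univ, true_and] at hy
    rw [extend_extend, ← hy, extend_eq_self]
  · intro y hy
    simp only [Finset.mem_filter, Finset.mem_univ, true_and] at hy
    rw [extend_extend, ← hy, extend_eq_self]

open Classical in
/-- The matrix of the state `Ψ` with respect to the splitting of the wires into the wires `e` and
the others; the column index is a bit string with zeros on the wires `e`. -/
def slice (e : Fin n ↪ Fin w) (Ψ : Bits w → ℂ) : Matrix (Bits n) (Bits w) ℂ :=
  fun x y => if y ∘ e = fun _ => false then Ψ (Function.extend e x y) else 0

open Classical in
theorem sum_norm_sq_slice (e : Fin n ↪ Fin w) (Ψ : Bits w → ℂ) (x : Bits n) :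
    ∑ y, ‖slice e Ψ x y‖ ^ 2 = ∑ y, if y ∘ e = x then ‖Ψ y‖ ^ 2 else 0 := by
  rw [sum_fiber e x fun y => ‖Ψ y‖ ^ 2]
  refine Finset.sum_congr rfl fun y _ => ?_
  unfold slice
  split_ifs <;> simp

theorem slice_embed_mulVec (e : Fin n ↪ Fin w) (V : Op n) (Ψ : Bits w → ℂ) :
    slice e ((embed e V).mulVec Ψ) = V * slice e Ψ := by
  classical
  ext x y
  rw [Matrix.mul_apply]
  unfold slice
  by_cases hy : y ∘ e = fun _ => false
  · simp only [if_pos hy, Matrix.mulVec, dotProduct, embed_apply, ite_mul, zero_mul]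
    rw [sum_agree_off_range e (Function.extend e x y)
      fun z => V (Function.extend e x y ∘ e) (z ∘ e) * Ψ z]
    simp only [extend_extend, extend_comp_embedding]
  · simp [if_neg hy]

end Slice

namespace Algorithm

variable {n : ℕ}

theorem outputDensity_eq (A : Algorithm n) (ψ : Bits n → ℂ) :
    A.outputDensity ψ = slice A.out (A.finalState ψ) * (slice A.out (A.finalState ψ))ᴴ := by
  classical
  ext x x'
  set Ψ := A.finalState ψ with hΨ
  have h1 : ∀ y, ∑ y' : Bits A.width,
      (if y ∘ A.out = x ∧ y' ∘ A.out = x' ∧ ∀ i, i ∉ Set.range A.out → y i = y' i then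
        Ψ y * star (Ψ y') else 0) =
      if y ∘ A.out = x then Ψ y * star (Ψ (Function.extend A.out x' y)) else 0 := by
    intro y
    have h2 : ∀ y', (if y ∘ A.out = x ∧ y' ∘ A.out = x' ∧
        ∀ i, i ∉ Set.range A.out → y i = y' i then Ψ y * star (Ψ y') else 0) =
        if ∀ i, i ∉ Set.range A.out → y i = y' i then
          (if y' ∘ A.out = x' then (if y ∘ A.out = x then Ψ y * star (Ψ y') else 0) else 0)
        else 0 := by
      intro y'
      rw [← ite_and, ← ite_and]
      exact if_congr (by tauto) rfl rfl
    rw [Finset.sum_congr rfl fun y' _ => h2 y', sum_agree_off_range A.out y fun y' =>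
      if y' ∘ A.out = x' then (if y ∘ A.out = x then Ψ y * star (Ψ y') else 0) else 0]
    simp only [extend_comp_embedding, Finset.sum_ite_eq', Finset.mem_univ, if_true]
  have h3 : A.outputDensity ψ x x' = ∑ y : Bits A.width,
      if y ∘ A.out = x then Ψ y * star (Ψ (Function.extend A.out x' y)) else 0 := by
    rw [← Finset.sum_congr rfl fun y _ => h1 y]
    unfold outputDensity
    refine Finset.sum_congr rfl fun y _ => Finset.sum_congr rfl fun y' _ => ?_
    exact if_congr Iff.rfl rfl rfl
  rw [h3, sum_fiber, Matrix.mul_apply]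
  refine Finset.sum_congr rfl fun y _ => ?_
  rw [Matrix.conjTranspose_apply]
  unfold slice
  split_ifs
  · rw [extend_extend]
  · simp

theorem sum_norm_sq_initState (A : Algorithm n) (ψ : Bits n → ℂ) :
    ∑ y, ‖A.initState ψ y‖ ^ 2 = ∑ x, ‖ψ x‖ ^ 2 := by
  classical
  have h := sum_agree_off_range A.inp (fun _ => false) fun y => ‖ψ (y ∘ A.inp)‖ ^ 2
  simp only [extend_comp_embedding] at h
  rw [← h]
  refine Finset.sum_congr rfl fun y _ => ?_
  unfold initState
  simp only [eq_comm (a := false)]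
  split_ifs <;> simp

theorem trace_outputDensity (A : Algorithm n) {ψ : Bits n → ℂ} (hψ : ∑ x, ‖ψ x‖ ^ 2 = 1) :
    (A.outputDensity ψ).trace = 1 := by
  classical
  set S := slice A.out (A.finalState ψ) with hS
  have h : (∑ x, ∑ y, ‖S x y‖ ^ 2 : ℝ) = 1 := by
    rw [hS, Finset.sum_congr rfl fun x _ => sum_norm_sq_slice _ _ x, Finset.sum_comm]
    simp only [Finset.sum_ite_eq, Finset.mem_univ, if_true]
    rw [finalState, sum_norm_sq_mulVec_of_mem_unitary A.circuit.toOp_mem_unitary,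
      sum_norm_sq_initState, hψ]
  rw [outputDensity_eq, ← hS, Matrix.trace]
  have h2 : ∀ x, (S * Sᴴ).diag x = ((∑ y, ‖S x y‖ ^ 2 : ℝ) : ℂ) := by
    intro x
    rw [Matrix.diag_apply, Matrix.mul_apply]
    push_cast
    exact Finset.sum_congr rfl fun y _ => Complex.mul_conj' (S x y)
  rw [Finset.sum_congr rfl fun x _ => h2 x, ← Complex.ofReal_sum, h, Complex.ofReal_one]

/-- The algorithm `A` followed by the gates `L` on its output wires, which are then read in the
order given by `σ`. -/
def post (A : Algorithm n) (L : List (PlacedGate n)) (σ : Equiv.Perm (Fin n)) : Algorithm n where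
  width := A.width
  inp := A.inp
  out := σ.toEmbedding.trans A.out
  circuit :=
    { layers := A.circuit.layers ++ L.map fun p => [p.relabel A.out]
      disjoint := by
        intro l hl
        rw [List.mem_append, List.mem_map] at hl
        rcases hl with hl | ⟨p, _, rfl⟩
        · exact A.circuit.disjoint l hl
        · exact List.pairwise_singleton _ _ }

theorem flatten_post (A : Algorithm n) (L : List (PlacedGate n)) (σ : Equiv.Perm (Fin n)) :
    (A.post L σ).circuit.layers.flatten =
      A.circuit.layers.flatten ++ L.map fun p => p.relabel A.out := by
  have : (L.map fun p => [p.relabel A.out]).flatten = L.map fun p => p.relabel A.out := by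
    induction L with
    | nil => rfl
    | cons p L ih => rw [List.map_cons, List.flatten_cons, ih, List.map_cons, List.singleton_append]
  rw [← this, ← List.flatten_append]
  rfl

theorem depth_post (A : Algorithm n) (L : List (PlacedGate n)) (σ : Equiv.Perm (Fin n)) :
    (A.post L σ).circuit.depth = A.circuit.depth + L.length := by
  change (A.circuit.layers ++ L.map fun p => [p.relabel A.out]).length = _
  rw [List.length_append, List.length_map]
  rfl

theorem size_post (A : Algorithm n) (L : List (PlacedGate n)) (σ : Equiv.Perm (Fin n)) :
    (A.post L σ).circuit.size = A.circuit.size + L.length := by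
  refine (congrArg List.length (A.flatten_post L σ)).trans ?_
  exact List.length_append.trans (congrArg _ (List.length_map _))

theorem isOver_post {A : Algorithm n} {G : Set Gate} (hA : A.circuit.IsOver G)
    {L : List (PlacedGate n)} (hL : ∀ p ∈ L, p.gate ∈ G) (σ : Equiv.Perm (Fin n)) :
    (A.post L σ).circuit.IsOver G := by
  intro p hp
  have hp' : p ∈ A.circuit.layers.flatten ++ L.map fun p => p.relabel A.out :=
    A.flatten_post L σ ▸ hp
  rcases List.mem_append.1 hp' with hp | hp
  · exact hA p hp
  · obtain ⟨p₀, hp₀, rfl⟩ := List.mem_map.1 hp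
    exact hL p₀ hp₀

theorem finalState_post (A : Algorithm n) (L : List (PlacedGate n)) (σ : Equiv.Perm (Fin n))
    (ψ : Bits n → ℂ) :
    (A.post L σ).finalState ψ = (embed A.out (gatesOp L)).mulVec (A.finalState ψ) := by
  have h1 : ((A.post L σ).circuit.toOp : Op A.width) =
      gatesOp (A.circuit.layers.flatten ++ L.map fun p => p.relabel A.out) :=
    congrArg gatesOp (A.flatten_post L σ)
  rw [gatesOp_append, gatesOp_map_relabel] at h1
  change Matrix.mulVec ((A.post L σ).circuit.toOp : Op A.width) (A.initState ψ) = _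
  rw [h1, finalState, Matrix.mulVec_mulVec]
  rfl

theorem outputProb_post (A : Algorithm n) (L : List (PlacedGate n)) (σ : Equiv.Perm (Fin n))
    (x z : Bits n) :
    (A.post L σ).outputProb x z =
      ∑ y, ‖(gatesOp L * slice A.out (A.finalState (Pi.single x 1))) (z ∘ ⇑σ⁻¹) y‖ ^ 2 := by
  classical
  rw [← slice_embed_mulVec, sum_norm_sq_slice, ← finalState_post A L σ]
  unfold outputProb
  refine Finset.sum_congr rfl fun y _ => if_congr ?_ rfl rfl
  have := eq_comp_perm_iff σ z (y ∘ A.out)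
  constructor
  · intro h
    exact this.1 h.symm
  · intro h
    exact (this.2 h).symm

end Algorithm

/-! ### Fidelity and trace distance -/

section Fidelity

variable {n : ℕ}

/-- If `ρ` is within trace distance `ε` of a pure state `χ` then `⟨χ|ρ|χ⟩ ≥ 1 - ε`: with
`Δ = ρ - |χ⟩⟨χ|`, both `|Δ| + Δ` and `|Δ| - Δ` are positive, so `2 ⟨χ|-Δ|χ⟩ ≤ tr (|Δ| - Δ)`. -/
theorem one_sub_le_fidelity_of_traceDist_le {ρ : Op n} (hρ : ρ.IsHermitian) (htr : ρ.trace = 1)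
    {χ : Bits n → ℂ} (hχ : ∑ x, ‖χ x‖ ^ 2 = 1) {ε : ℝ}
    (h : traceDist ρ (Matrix.vecMulVec χ (star χ)) ≤ ε) :
    1 - ε ≤ (star χ ⬝ᵥ ρ.mulVec χ).re := by
  have hχ' : star χ ⬝ᵥ χ = 1 := by
    rw [← Complex.ofReal_one, ← hχ]
    push_cast
    exact Finset.sum_congr rfl fun x _ => Complex.conj_mul' (χ x)
  set P : Op n := Matrix.vecMulVec χ (star χ) with hP
  have hPherm : P.IsHermitian := by
    rw [Matrix.IsHermitian, hP, Matrix.conjTranspose_vecMulVec, star_star]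
  set Δ := ρ - P with hΔ
  have hsa : IsSelfAdjoint Δ := hρ.sub hPherm
  have hadd : (CFC.abs Δ + Δ).PosSemidef := by
    rw [← Matrix.nonneg_iff_posSemidef, CFC.abs_add_self Δ hsa]
    exact smul_nonneg (by norm_num) (CFC.posPart_nonneg Δ)
  have hsub : (CFC.abs Δ - Δ).PosSemidef := by
    rw [← Matrix.nonneg_iff_posSemidef, CFC.abs_sub_self Δ hsa]
    exact smul_nonneg (by norm_num) (CFC.negPart_nonneg Δ)
  have hPtr : P.trace = 1 := by
    rw [hP, Matrix.trace_vecMulVec, dotProduct_comm, hχ']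
  -- the expectation of a positive operator in a unit vector is at most its trace
  have hle : (star χ ⬝ᵥ (CFC.abs Δ - Δ).mulVec χ).re ≤ (CFC.abs Δ - Δ).trace.re := by
    obtain ⟨B, hB⟩ := CStarAlgebra.nonneg_iff_eq_star_mul_self.1 hsub.nonneg
    rw [Matrix.star_eq_conjTranspose] at hB
    have h1 : star χ ⬝ᵥ (Bᴴ * B).mulVec χ = ((∑ i, ‖B.mulVec χ i‖ ^ 2 : ℝ) : ℂ) := by
      rw [← Matrix.mulVec_mulVec, Matrix.dotProduct_mulVec, ← Matrix.star_mulVec]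
      push_cast
      exact Finset.sum_congr rfl fun i _ => Complex.conj_mul' (B.mulVec χ i)
    have h2 : (Bᴴ * B).trace = ((∑ i, ∑ j, ‖B i j‖ ^ 2 : ℝ) : ℂ) := by
      rw [Matrix.trace_mul_comm]
      push_cast
      refine Finset.sum_congr rfl fun i _ => ?_
      rw [Matrix.diag_apply, Matrix.mul_apply]
      exact Finset.sum_congr rfl fun j _ => Complex.mul_conj' (B i j)
    rw [hB, h1, h2, Complex.ofReal_re, Complex.ofReal_re]
    refine Finset.sum_le_sum fun i _ => ?_
    have h3 : ‖B.mulVec χ i‖ ≤ ∑ j, ‖B i j‖ * ‖χ j‖ := by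
      refine (norm_sum_le _ _).trans_eq ?_
      exact Finset.sum_congr rfl fun j _ => norm_mul _ _
    calc ‖B.mulVec χ i‖ ^ 2 ≤ (∑ j, ‖B i j‖ * ‖χ j‖) ^ 2 := by gcongr
      _ ≤ (∑ j, ‖B i j‖ ^ 2) * ∑ j, ‖χ j‖ ^ 2 := Finset.sum_mul_sq_le_sq_mul_sq _ _ _
      _ = ∑ j, ‖B i j‖ ^ 2 := by rw [hχ, mul_one]
  have hnn : 0 ≤ (star χ ⬝ᵥ (CFC.abs Δ + Δ).mulVec χ).re :=
    (Complex.le_def.1 (hadd.dotProduct_mulVec_nonneg χ)).1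
  have hΔtr : Δ.trace = 0 := by rw [hΔ, Matrix.trace_sub, htr, hPtr, sub_self]
  rw [Matrix.trace_sub, hΔtr, sub_zero, Matrix.sub_mulVec, dotProduct_sub, Complex.sub_re] at hle
  rw [Matrix.add_mulVec, dotProduct_add, Complex.add_re] at hnn
  have hΔχ : (star χ ⬝ᵥ Δ.mulVec χ).re = (star χ ⬝ᵥ ρ.mulVec χ).re - 1 := by
    rw [hΔ, Matrix.sub_mulVec, dotProduct_sub, Complex.sub_re, hP, Matrix.vecMulVec_mulVec, hχ']
    simp [hχ']
  unfold traceDist at h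
  linarith

theorem fidelity_mul_conjTranspose {w : ℕ} (S : Matrix (Bits n) (Bits w) ℂ) (χ : Bits n → ℂ) :
    (star χ ⬝ᵥ (S * Sᴴ).mulVec χ).re = ∑ y, ‖Matrix.vecMul (star χ) S y‖ ^ 2 := by
  have h : star χ ⬝ᵥ (S * Sᴴ).mulVec χ = ((∑ y, ‖Matrix.vecMul (star χ) S y‖ ^ 2 : ℝ) : ℂ) := by
    have h1 : Sᴴ.mulVec χ = star (Matrix.vecMul (star χ) S) := by
      rw [Matrix.star_vecMul, star_star]
    rw [← Matrix.mulVec_mulVec, Matrix.dotProduct_mulVec, h1]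
    push_cast
    exact Finset.sum_congr rfl fun y _ => Complex.mul_conj' _
  rw [h, Complex.ofReal_re]

end Fidelity

/-! ### From simulation to computation -/

section Extraction

variable {n : ℕ} {G : Set Gate}

/-- If `Q ξ` is the basis vector `z` up to phase, then the overlap of a state with `ξ` is the
amplitude of `z` after `Q` has been applied to the state. -/
theorem norm_vecMul_star_eq {w : ℕ} {Q : Op n} (hQ : Q ∈ unitary (Op n)) {ξ : Bits n → ℂ} {α : ℂ}
    {z : Bits n} (h : Q.mulVec ξ = α • Pi.single z 1) (hα : ‖α‖ ^ 2 = 1)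
    (S : Matrix (Bits n) (Bits w) ℂ) (y : Bits w) :
    ‖Matrix.vecMul (star ξ) S y‖ ^ 2 = ‖(Q * S) z y‖ ^ 2 := by
  have h1 : S = Qᴴ * (Q * S) := by
    rw [← Matrix.mul_assoc, ← Matrix.star_eq_conjTranspose, (Unitary.mem_iff.1 hQ).1,
      Matrix.one_mul]
  have h2 : Matrix.vecMul (star ξ) S = star α • (Q * S).row z := by
    conv_lhs => rw [h1]
    rw [← Matrix.vecMul_vecMul, ← Matrix.star_mulVec, h, star_smul, Matrix.smul_vecMul]
    congr 1
    have : star (Pi.single z (1 : ℂ) : Bits n → ℂ) = Pi.single z 1 := by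
      rw [← Pi.single_star, star_one]
    rw [this, Matrix.single_one_vecMul]
  rw [h2, Pi.smul_apply, smul_eq_mul, norm_mul, mul_pow, norm_star, hα, one_mul]
  rfl

theorem norm_sq_sum_star_mul_le {ι : Type*} {m : ℕ} {B : ℝ} {c : ℕ → ℂ} (hc : ∀ r, ‖c r‖ ≤ B)
    (a : ℕ → ι → ℂ) (y : ι) :
    ‖∑ r ∈ Finset.range m, star (c r) * a r y‖ ^ 2 ≤
      m * B ^ 2 * ∑ r ∈ Finset.range m, ‖a r y‖ ^ 2 := by
  have h1 : ‖∑ r ∈ Finset.range m, star (c r) * a r y‖ ≤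
      ∑ r ∈ Finset.range m, ‖c r‖ * ‖a r y‖ := by
    refine (norm_sum_le _ _).trans_eq (Finset.sum_congr rfl fun r _ => ?_)
    rw [norm_mul, norm_star]
  calc ‖∑ r ∈ Finset.range m, star (c r) * a r y‖ ^ 2
      ≤ (∑ r ∈ Finset.range m, ‖c r‖ * ‖a r y‖) ^ 2 := by gcongr
    _ ≤ (∑ r ∈ Finset.range m, ‖c r‖ ^ 2) * ∑ r ∈ Finset.range m, ‖a r y‖ ^ 2 :=
      Finset.sum_mul_sq_le_sq_mul_sq _ _ _
    _ ≤ m * B ^ 2 * ∑ r ∈ Finset.range m, ‖a r y‖ ^ 2 := by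
      gcongr
      refine (Finset.sum_le_card_nsmul _ _ (B ^ 2) fun r _ => ?_).trans_eq ?_
      · exact pow_le_pow_left₀ (norm_nonneg _) (hc r) 2
      · simp

/-- Suppose that `A` simulates a bounded combination `V = ∑ c r • W r`, and that every `W r` can be
completed with `N` gates to the same operator `permOp π * E`. On average over the `r`, the state
produced by `A` has at least the fidelity with `W r |x⟩` that it has with `V |x⟩`, up to the factor
`m² B²`. So one of the completions of `A` computes what `E` computes with probability at least
`(1 - ε) / (m² B²)`. -/
theorem Simulates.exists_successProb {A : Algorithm n} (hA : A.circuit.IsOver G) {V : Op n}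
    (hV : V ∈ unitary (Op n)) {ε : ℝ} (hsim : Simulates A V ε) {m : ℕ} (hm : 1 ≤ m) {B : ℝ}
    {c : ℕ → ℂ} (hc : ∀ r, ‖c r‖ ≤ B) {W R : ℕ → Op n}
    (hVW : V = ∑ r ∈ Finset.range m, c r • W r) {N : ℕ} (hR : ∀ r < m, IsGateProduct G N (R r))
    {E : Op n} (hE : E ∈ unitary (Op n)) {π : Equiv.Perm (Fin n)}
    (hRW : ∀ r < m, R r * W r = permOp π * E) {Xhat : Finset (Bits n)} (hne : Xhat.Nonempty)
    {F : Bits n → Bits n} (hF : ∀ x ∈ Xhat, ‖E (F x) x‖ ^ 2 = 1) :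
    ∃ A' : Algorithm n, A'.circuit.IsOver G ∧ A'.circuit.depth ≤ A.circuit.depth + N ∧
      A'.circuit.size ≤ A.circuit.size + N ∧
      1 - ε ≤ m ^ 2 * B ^ 2 * successProb A' Xhat F := by
  have hR' : ∀ r, ∃ (ρ : Equiv.Perm (Fin n)) (L : List (PlacedGate n)), r < m →
      (∀ p ∈ L, p.gate ∈ G) ∧ L.length ≤ N ∧ R r = permOp ρ * gatesOp L := by
    intro r
    by_cases hr : r < m
    · obtain ⟨ρ, L, h⟩ := hR r hr
      exact ⟨ρ, L, fun _ => h⟩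
    · exact ⟨1, [], fun h => absurd h hr⟩
  choose ρ L hL using hR'
  set A' : ℕ → Algorithm n := fun r => A.post (L r) (π * (ρ r)⁻¹)⁻¹ with hA'
  have hLW : ∀ r < m, gatesOp (L r) * W r = permOp (π * (ρ r)⁻¹) * E := by
    intro r hr
    have h1 : permOp (ρ r)⁻¹ * permOp (ρ r) = (1 : Op n) := by
      rw [permOp_mul, mul_inv_cancel, permOp_one]
    rw [← permOp_mul, mul_assoc, ← hRW r hr, (hL r hr).2.2, ← mul_assoc, ← mul_assoc, h1, one_mul]
  have hx : ∀ x ∈ Xhat, 1 - ε ≤ m * B ^ 2 * ∑ r ∈ Finset.range m, (A' r).outputProb x (F x) := by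
    intro x hx
    set S := slice A.out (A.finalState (Pi.single x 1)) with hS
    have hψ : ∑ y, ‖(Pi.single x (1 : ℂ) : Bits n → ℂ) y‖ ^ 2 = 1 := by
      rw [Finset.sum_eq_single x] <;> simp +contextual
    have hfid := one_sub_le_fidelity_of_traceDist_le (ρ := A.outputDensity (Pi.single x 1))
      (by rw [A.outputDensity_eq]; exact Matrix.isHermitian_mul_conjTranspose_self _)
      (A.trace_outputDensity hψ)
      (by rw [sum_norm_sq_mulVec_of_mem_unitary hV, hψ]) (hsim _ hψ)
    rw [A.outputDensity_eq, fidelity_mul_conjTranspose, ← hS] at hfid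
    refine hfid.trans ?_
    have hprob : ∀ r ∈ Finset.range m, (A' r).outputProb x (F x) =
        ∑ y, ‖Matrix.vecMul (star ((W r).mulVec (Pi.single x 1))) S y‖ ^ 2 := by
      intro r hr
      have hr' := Finset.mem_range.1 hr
      set τ := π * (ρ r)⁻¹ with hτ
      have hent : ‖(permOp τ * E) (F x ∘ τ) x‖ ^ 2 = 1 := by
        rw [permOp_mul_apply, ← (eq_comp_perm_iff τ (F x ∘ τ) (F x)).1 rfl]
        exact hF x hx
      have hcol := mulVec_single_eq_of_norm_eq_one (mul_mem (permOp_mem_unitary τ) hE) hent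
      rw [← hLW r hr', ← Matrix.mulVec_mulVec] at hcol
      rw [hLW r hr'] at hcol
      rw [hA', Algorithm.outputProb_post, ← hS, inv_inv]
      exact Finset.sum_congr rfl fun y _ =>
        (norm_vecMul_star_eq (gatesOp_mem_unitary (L r)) hcol hent S y).symm
    rw [Finset.sum_congr rfl hprob, Finset.sum_comm, Finset.mul_sum]
    refine Finset.sum_le_sum fun y _ => ?_
    have hlin : Matrix.vecMul (star (V.mulVec (Pi.single x 1))) S y =
        ∑ r ∈ Finset.range m,
          star (c r) * Matrix.vecMul (star ((W r).mulVec (Pi.single x 1))) S y := by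
      rw [hVW, Matrix.sum_mulVec, star_sum, Matrix.sum_vecMul, Finset.sum_apply]
      refine Finset.sum_congr rfl fun r _ => ?_
      rw [Matrix.smul_mulVec, star_smul, Matrix.smul_vecMul, Pi.smul_apply, smul_eq_mul]
    rw [hlin]
    exact norm_sq_sum_star_mul_le hc _ y
  -- some `r` does at least as well as the average
  have hcard : (0 : ℝ) < Xhat.card := by exact_mod_cast hne.card_pos
  have havg : 1 - ε ≤ m * B ^ 2 * ∑ r ∈ Finset.range m, successProb (A' r) Xhat F := by
    have h1 : Xhat.card * (1 - ε) ≤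
        m * B ^ 2 * ∑ r ∈ Finset.range m, ∑ x ∈ Xhat, (A' r).outputProb x (F x) := by
      rw [Finset.sum_comm, Finset.mul_sum, ← nsmul_eq_mul]
      exact Finset.card_nsmul_le_sum _ _ _ hx
    unfold successProb
    rw [← Finset.sum_div, mul_div_assoc', le_div_iff₀ hcard, mul_comm]
    exact h1
  obtain ⟨r, hr, hmax⟩ := Finset.exists_max_image (Finset.range m)
    (fun r => successProb (A' r) Xhat F) ⟨0, Finset.mem_range.2 hm⟩
  obtain ⟨hLG, hLN, -⟩ := hL r (Finset.mem_range.1 hr)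
  refine ⟨A' r, Algorithm.isOver_post hA hLG _, ?_, ?_, ?_⟩
  · exact (A.depth_post _ _).trans_le (Nat.add_le_add_left hLN _)
  · exact (A.size_post _ _).trans_le (Nat.add_le_add_left hLN _)
  · refine havg.trans ?_
    have h1 : ∑ r ∈ Finset.range m, successProb (A' r) Xhat F ≤ m * successProb (A' r) Xhat F := by
      refine (Finset.sum_le_card_nsmul _ _ _ hmax).trans_eq ?_
      simp
    calc m * B ^ 2 * ∑ r ∈ Finset.range m, successProb (A' r) Xhat F
        ≤ m * B ^ 2 * (m * successProb (A' r) Xhat F) := by gcongr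
      _ = m ^ 2 * B ^ 2 * successProb (A' r) Xhat F := by ring

/-- The powers of a circuit that computes `g` on `X` compute the iterates of `g`. -/
theorem Computes.norm_sq_pow_apply {C : Circuit n} {X : Set (Bits n)} {g : Bits n → Bits n}
    (hC : Computes C X g) (hg : Set.MapsTo g X X) (k : ℕ) {x : Bits n} (hx : x ∈ X) :
    ‖(C.toOp ^ k) (g^[k] x) x‖ ^ 2 = 1 := by
  induction k with
  | zero => simp
  | succ k ih =>
    have h1 := mulVec_single_eq_of_norm_eq_one (pow_mem C.toOp_mem_unitary k) ih
    have h2 : (C.toOp ^ (k + 1)).mulVec (Pi.single x 1) (g^[k + 1] x) =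
        (C.toOp ^ k) (g^[k] x) x * C.toOp (g^[k + 1] x) (g^[k] x) := by
      rw [pow_succ', ← Matrix.mulVec_mulVec, h1, Matrix.mulVec_smul, Matrix.mulVec_single_one]
      rfl
    rw [Matrix.mulVec_single_one] at h2
    change (C.toOp ^ (k + 1)) (g^[k + 1] x) x = _ at h2
    rw [h2, norm_mul, mul_pow, ih, one_mul, Function.iterate_succ_apply']
    exact hC _ (hg.iterate k hx)

end Extraction

/-! ### Polynomials with natural coefficients -/

section Asymptotics

open Filter Asymptotics

theorem monotone_eval_nat (q : Polynomial ℕ) : Monotone fun a : ℕ => q.eval a := by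
  intro a b hab
  simp only [Polynomial.eval_eq_sum_range]
  gcongr

theorem eval_nat_le_mul_pow (q : Polynomial ℕ) {n : ℕ} (hn : 1 ≤ n) :
    q.eval n ≤ q.eval 1 * n ^ q.natDegree := by
  rw [Polynomial.eval_eq_sum_range, Polynomial.eval_eq_sum_range, Finset.sum_mul]
  refine Finset.sum_le_sum fun i hi => ?_
  rw [one_pow, mul_one]
  exact Nat.mul_le_mul_left _
    (Nat.pow_le_pow_right hn (Nat.lt_succ_iff.1 (Finset.mem_range.1 hi)))

theorem eval_nat_pos {q : Polynomial ℕ} (hq : q ≠ 0) {n : ℕ} (hn : 1 ≤ n) : 0 < q.eval n := by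
  rw [Polynomial.eval_eq_sum_range]
  refine lt_of_lt_of_le ?_ (Finset.single_le_sum (f := fun i => q.coeff i * n ^ i)
    (fun _ _ => Nat.zero_le _) (Finset.mem_range.2 q.natDegree.lt_succ_self))
  refine Nat.mul_pos (Nat.pos_of_ne_zero ?_) (pow_pos hn _)
  exact Polynomial.leadingCoeff_ne_zero.2 hq

theorem isLittleO_log_eval_nat (q : Polynomial ℕ) :
    (fun n : ℕ => Real.log (q.eval n : ℕ)) =o[atTop] fun n : ℕ => (n : ℝ) := by
  have hlog : (fun n : ℕ => Real.log n) =o[atTop] fun n : ℕ => (n : ℝ) :=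
    Real.isLittleO_log_id_atTop.comp_tendsto tendsto_natCast_atTop_atTop
  have hconst : (fun _ : ℕ => Real.log (q.eval 1 : ℕ)) =o[atTop] fun n : ℕ => (n : ℝ) :=
    (isLittleO_const_id_atTop _).comp_tendsto tendsto_natCast_atTop_atTop
  have hsum := hconst.add (hlog.const_mul_left (q.natDegree : ℝ))
  refine IsBigO.trans_isLittleO (IsBigO.of_bound 1 ?_) hsum
  filter_upwards [eventually_ge_atTop 1] with n hn
  rw [one_mul]
  rcases eq_or_ne q 0 with rfl | hq
  · simp
  have hpos : 0 < q.eval n := eval_nat_pos hq hn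
  have h1 : 0 ≤ Real.log (q.eval n : ℕ) := Real.log_natCast_nonneg _
  rw [Real.norm_of_nonneg h1]
  refine le_trans ?_ (le_abs_self _)
  rw [← Real.log_pow, ← Real.log_mul (by exact_mod_cast (eval_nat_pos hq le_rfl).ne')
    (pow_ne_zero _ (by exact_mod_cast (by omega)))]
  refine Real.log_le_log (by exact_mod_cast hpos) ?_
  exact_mod_cast eval_nat_le_mul_pow q hn

theorem eventually_eval_mul_lt_of_superpolynomialDecay {μ : ℕ → ℝ}
    (hμ : SuperpolynomialDecay atTop (fun n : ℕ => (n : ℝ)) μ) (p : Polynomial ℕ) {κ : ℝ}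
    (hκ : 0 < κ) : ∀ᶠ n : ℕ in atTop, (p.eval n : ℕ) * μ n < κ := by
  have h := (hμ.polynomial_mul (p.map (Nat.castRingHom ℝ))) 0
  simp only [pow_zero, one_mul] at h
  filter_upwards [h.eventually (gt_mem_nhds hκ)] with n hn
  have : (p.map (Nat.castRingHom ℝ)).eval (n : ℝ) = (p.eval n : ℕ) := by
    rw [Polynomial.eval_natCast_map]
    rfl
  rwa [this] at hn

end Asymptotics

/-! ### Completing a simulation to a computation of the next iterate -/

section Completion

variable {n : ℕ} {G : Set Gate}

theorem IsGeomLocal.isHermitian {k : ℕ} {b : ℝ} {A : Op n} (hA : IsGeomLocal k b A) :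
    A.IsHermitian := by
  obtain ⟨h, rfl, hh⟩ := hA
  exact isSelfAdjoint_sum _ fun l _ => (hh l).1

theorem exp_mem_unitary_of_isHermitian {A : Op n} (hA : A.IsHermitian) (τ : ℝ) :
    NormedSpace.exp (τ • (-Complex.I • A)) ∈ unitary (Op n) := by
  let : NormedAlgebra ℚ (Op n) := .restrictScalars ℚ ℂ _
  refine NormedSpace.exp_mem_unitary_of_mem_skewAdjoint ?_
  have hA' : star A = A := hA
  rw [skewAdjoint.mem_iff, star_smul, star_smul, hA']
  simp

theorem slotProd_mem_unitary {v : ℕ → Op n} (hv : ∀ j, v j ∈ unitary (Op n)) (j : ℕ) :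
    slotProd v j ∈ unitary (Op n) := by
  induction j with
  | zero => exact one_mem _
  | succ j ih => exact mul_mem (hv j) ih

theorem isGateProduct_slotProd {v : ℕ → Op n} (hv : ∀ j, IsSlotOp G (v j)) (j : ℕ) :
    IsGateProduct G j (slotProd v j) := by
  induction j with
  | zero => exact isGateProduct_one _ _
  | succ j ih =>
    have := (hv j).isGateProduct.mul ih
    rwa [add_comm] at this

theorem slotEvolution_eq_exp_mul {X : ℕ → Op n} {N : ℕ} {t : ℝ} (h0 : 0 ≤ t) (hN : t ≤ N) :
    slotEvolution X N t = NormedSpace.exp ((t - ⌊t⌋₊) • (-Complex.I • X ⌊t⌋₊)) *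
      slotProd (fun j => NormedSpace.exp (-Complex.I • X j)) ⌊t⌋₊ := by
  rcases hN.lt_or_eq with hN | rfl
  · exact slotEvolution_of_mem_Icc ((Nat.floor_lt h0).2 hN)
      ⟨Nat.floor_le h0, (Nat.lt_floor_add_one t).le⟩
  · rw [Nat.floor_natCast, slotEvolution_of_le le_rfl, sub_self, zero_smul, NormedSpace.exp_zero,
      one_mul]

theorem pow_mul_mul_star_pow {V : Op n} (hV : V ∈ unitary (Op n)) (r : ℕ) :
    V ^ r * (V * star V ^ r) = V := by
  have hcomm : Commute V (star V) := by
    rw [Commute, SemiconjBy, (Unitary.mem_iff.1 hV).1, (Unitary.mem_iff.1 hV).2]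
  rw [← mul_assoc, ← pow_succ, pow_succ', mul_assoc, ← hcomm.mul_pow, (Unitary.mem_iff.1 hV).2,
    one_pow, mul_one]

/-- A simulation of the evolution up to a time `t` before the end of the repetition `k + 1`
can be completed, with at most `m + M` gates, to an algorithm that computes what `k + 1` repetitions
compute. The partial slot at time `t` is a bounded combination of the operators `V V⁻ʳ` with `V`
the full slot: applying `Vʳ` turns the `r`-th of them into the full slot. -/
theorem exists_successProb_of_simulates_slotEvolution {v X : ℕ → Op n} {b B : ℝ} {m : ℕ}
    (hm : 1 ≤ m) (hv : ∀ j, IsSlotOp G (v j)) (hloc : ∀ j, IsGeomLocal 2 b (X j))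
    (hgen : ∀ j, IsBoundedGenerator m B (X j) (v j)) {M N k : ℕ} {t : ℝ} (ht0 : 0 ≤ t)
    (htN : t ≤ N) (hk0 : k * M ≤ ⌊t⌋₊) (hk1 : ⌊t⌋₊ < (k + 1) * M) {E : Op n}
    (hE : E ∈ unitary (Op n)) {π : Equiv.Perm (Fin n)}
    (hprod : slotProd v ((k + 1) * M) = permOp π * E) {Xhat : Finset (Bits n)}
    (hne : Xhat.Nonempty) {F : Bits n → Bits n} (hF : ∀ x ∈ Xhat, ‖E (F x) x‖ ^ 2 = 1)
    {A : Algorithm n} (hA : A.circuit.IsOver G) {ε : ℝ}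
    (hsim : Simulates A (slotEvolution X N t) ε) :
    ∃ A' : Algorithm n, A'.circuit.IsOver G ∧ A'.circuit.depth ≤ A.circuit.depth + (m + M) ∧
      A'.circuit.size ≤ A.circuit.size + (m + M) ∧
      1 - ε ≤ m ^ 2 * B ^ 2 * successProb A' Xhat F := by
  set j := ⌊t⌋₊ with hj
  have hexp : (fun j => NormedSpace.exp (-Complex.I • X j)) = v := funext fun j => (hgen j).1
  have hU := slotEvolution_eq_exp_mul (X := X) ht0 htN
  rw [hexp, ← hj] at hU
  have hvu : ∀ j, v j ∈ unitary (Op n) := fun j => (hv j).mem_unitary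
  obtain ⟨c, hc, e⟩ := (hgen j).2 (t - j)
  obtain ⟨l, hl⟩ := Nat.exists_eq_add_of_le (Nat.succ_le_of_lt hk1)
  refine hsim.exists_successProb hA ?_ hm hc (E := E) (π := π)
    (W := fun r => v j * star (v j) ^ r * slotProd v j)
    (R := fun r => slotProd (fun i => v (j + 1 + i)) l * v j ^ r) ?_ ?_ hE ?_ hne hF
  · rw [hU]
    exact mul_mem (exp_mem_unitary_of_isHermitian (hloc j).isHermitian _)
      (slotProd_mem_unitary hvu j)
  · rw [hU, e, Finset.sum_mul]
    exact Finset.sum_congr rfl fun r _ => smul_mul_assoc _ _ _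
  · intro r hr
    refine ((isGateProduct_slotProd (fun i => hv _) l).mul
      ((hv j).isGateProduct.pow r)).mono ?_
    have : (k + 1) * M = k * M + M := Nat.succ_mul k M
    omega
  · intro r _
    rw [← hprod, hl, slotProd_add, Nat.succ_eq_add_one, slotProd]
    conv_rhs => rw [← pow_mul_mul_star_pow (hvu j) r]
    simp only [mul_assoc]

end Completion

/-! ### The lower bound on the depth of a simulation -/

/-- The lower bound, for slot sequences that repeat a circuit computing the iterated function. If it
failed, then `n * s n ≤ d k`, so a simulating circuit of polynomial size would have size polynomial
in `k + d k + n`, and its completion would contradict the hardness of the iterate `k + 1`. -/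
theorem depth_le_of_isIteratedParallelHard {G : Set Gate} {s d : ℕ → ℕ}
    {X : (n : ℕ) → Set (Bits n)} {Xhat : (n : ℕ) → Finset (Bits n)}
    {f : (n : ℕ) → ℕ → Bits n → Bits n} (hf : IsIteratedParallelHard G s d X Xhat f)
    (T : Polynomial ℕ) {C : (n : ℕ) → Circuit n} {v H : (n : ℕ) → ℕ → Op n} {b B : ℝ} {m : ℕ}
    (hm : 1 ≤ m) (hB : 1 ≤ B) (hv : ∀ n j, IsSlotOp G (v n j))
    (hloc : ∀ n j, IsGeomLocal 2 b (H n j)) (hgen : ∀ n j, IsBoundedGenerator m B (H n j) (v n j))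
    (hprod : ∀ n k, ∃ π : Equiv.Perm (Fin n),
      slotProd (v n) (k * (n * s n)) = permOp π * (C n).toOp ^ k)
    (hC : ∀ n k, ∀ x ∈ Xhat n, ‖((C n).toOp ^ k) (f n k x) x‖ ^ 2 = 1)
    {p : Polynomial ℕ} (hp : p ≠ 0) (q : Polynomial ℕ) :
    ∀ᶠ n : ℕ in Filter.atTop, ∀ t ∈ Set.Icc (0 : ℝ) (n * s n * T.eval n), ∀ ε : ℝ,
      ε ≤ 1 - 1 / ((p.eval n : ℕ) : ℝ) → ∀ A : Algorithm n, A.circuit.IsOver G →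
        A.circuit.size ≤ q.eval (n + ⌈t⌉₊ + d ⌊t / (n * s n)⌋₊) →
        Simulates A (slotEvolution (H n) (n * s n * T.eval n) t) ε →
        d ⌊t / (n * s n)⌋₊ ≤ A.circuit.depth + (m + 1) * (n * s n) := by
  set q' : Polynomial ℕ := q.comp (Polynomial.X ^ 2 + Polynomial.X) + Polynomial.X with hq'
  have hq'eval : ∀ z : ℕ, q'.eval z = q.eval (z ^ 2 + z) + z := by
    intro z
    simp [hq']
  obtain ⟨k₀, μ, hμ, hhard⟩ := hf.hard q' (fun n => (T + 1).eval n) (isLittleO_log_eval_nat (T + 1))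
  obtain ⟨c₀, hc₀, hs⟩ := hf.size_lower
  obtain ⟨a₁, a₂, -, -, hcard⟩ := hf.card
  have hκ : (0 : ℝ) < 1 / (m ^ 2 * B ^ 2) := by
    have : (0 : ℝ) < m := by exact_mod_cast hm
    positivity
  filter_upwards [hs, hcard, eventually_eval_mul_lt_of_superpolynomialDecay hμ p hκ,
    Filter.eventually_ge_atTop 1, Filter.eventually_ge_atTop (d k₀)]
    with n hsn hcardn hμn hn1 hnd t ht ε hε A hA hsize hsim
  have hn0 : (0 : ℝ) < n := by exact_mod_cast hn1
  have hs1 : 1 ≤ s n := by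
    have : (0 : ℝ) < s n := lt_of_lt_of_le (by positivity) hsn
    exact_mod_cast this
  have hne : (Xhat n).Nonempty := by
    rw [← Finset.card_pos]
    have : (0 : ℝ) < (Xhat n).card := lt_of_lt_of_le (by positivity) hcardn.1
    exact_mod_cast this
  set M : ℕ := n * s n with hM
  have hMcast : (n : ℝ) * s n = (M : ℝ) := by rw [hM, Nat.cast_mul]
  rw [hMcast] at ht hsize ⊢
  set k : ℕ := ⌊t / (M : ℝ)⌋₊ with hk
  have hnM : n ≤ M := Nat.le_mul_of_pos_right n hs1
  have hM1 : 1 ≤ M := hn1.trans hnM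
  have hM0 : (0 : ℝ) < M := by exact_mod_cast hM1
  by_contra! hlt
  -- the repetition in progress at time `t`
  have hkM : (k : ℝ) * M ≤ t := by
    rw [← le_div_iff₀ hM0]
    exact Nat.floor_le (div_nonneg ht.1 hM0.le)
  have htk : t < ((k + 1) * M : ℕ) := by
    push_cast
    rw [← div_lt_iff₀ hM0]
    exact Nat.lt_floor_add_one _
  have hMd : (m + 1) * M < d k := by omega
  have hMd' : M ≤ d k := (Nat.le_mul_of_pos_left M m.succ_pos).trans hMd.le
  -- `k ≤ k₀` is impossible: `d k₀` is a constant, but `d k` exceeds `M`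
  have hk0 : k₀ ≤ k + 1 := by
    by_contra! h
    have := hf.monotone (show k ≤ k₀ by omega)
    have h1 : M ≤ (m + 1) * M := Nat.le_mul_of_pos_left M m.succ_pos
    omega
  have hkT : k + 1 ≤ (T + 1).eval n := by
    have h1 : t / M ≤ (T.eval n : ℕ) := by
      rw [div_le_iff₀ hM0, mul_comm]
      exact ht.2
    have h2 : k ≤ T.eval n := by
      have := Nat.floor_le_floor h1
      rwa [Nat.floor_natCast] at this
    rw [Polynomial.eval_add, Polynomial.eval_one]
    omega
  obtain ⟨π, hπ⟩ := hprod n (k + 1)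
  obtain ⟨A', hA'G, hdepth, hsize', hprob⟩ :=
    exists_successProb_of_simulates_slotEvolution hm (hv n) (hloc n) (hgen n) (M := M) (k := k)
      ht.1 (by push_cast; exact ht.2) (Nat.le_floor (by push_cast; exact hkM))
      ((Nat.floor_lt ht.1).2 htk) (pow_mem (C n).toOp_mem_unitary (k + 1)) hπ hne (hC n (k + 1))
      hA hsim
  have hmM : m + M ≤ (m + 1) * M := by
    rw [Nat.succ_mul]
    exact Nat.add_le_add_right (Nat.le_mul_of_pos_right m hM1) M
  have hdk : d k ≤ d (k + 1) := hf.monotone k.le_succ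
  have hbound := hhard n (k + 1) hk0 hkT A' hA'G (by omega) ?_
  · have hpn : (0 : ℝ) < (p.eval n : ℕ) := by exact_mod_cast eval_nat_pos hp hn1
    have hm0 : (0 : ℝ) < (m : ℝ) ^ 2 * B ^ 2 := one_div_pos.1 hκ
    have h1 : 1 / ((p.eval n : ℕ) : ℝ) ≤ m ^ 2 * B ^ 2 * μ n :=
      calc 1 / ((p.eval n : ℕ) : ℝ) ≤ 1 - ε := by linarith
        _ ≤ _ := hprob
        _ ≤ m ^ 2 * B ^ 2 * μ n := by gcongr
    rw [div_le_iff₀ hpn] at h1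
    rw [lt_div_iff₀ hm0] at hμn
    linarith
  · -- `M ≤ d k`, so everything is polynomial in `z`
    set z := k + 1 + d (k + 1) + n with hz
    rw [hq'eval]
    have h1 : ⌈t⌉₊ ≤ (k + 1) * M := Nat.ceil_le.2 htk.le
    have h2 : (k + 1) * M ≤ z ^ 2 := by
      rw [pow_two]
      exact Nat.mul_le_mul (by omega) (by omega)
    have h3 : A.circuit.size ≤ q.eval (z ^ 2 + z) :=
      hsize.trans (monotone_eval_nat q (by omega))
    omega

end ParallelSim

end

theorem mainTheorem3 (G : Set ParallelSim.Gate) (hG : G.Finite)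
    (harity : ∀ u ∈ G, u.1 = 1 ∨ u.1 = 2) :
    ∃ (b c : ℝ) (P : MvPolynomial (Fin 2) ℝ),
      ∀ (s d : ℕ → ℕ) (X : (n : ℕ) → Set (ParallelSim.Bits n))
        (Xhat : (n : ℕ) → Finset (ParallelSim.Bits n))
        (f : (n : ℕ) → ℕ → ParallelSim.Bits n → ParallelSim.Bits n) (T : Polynomial ℕ),
        ParallelSim.IsIteratedParallelHard G s d X Xhat f →
        ∃ (C : (n : ℕ) → ParallelSim.Circuit n) (H U : (n : ℕ) → ℝ → ParallelSim.Op n),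
          (∀ n, (C n).IsOver G ∧ (C n).size ≤ s n ∧
            ∀ k, ∀ x ∈ Xhat n, ‖((C n).toOp ^ k) (f n k x) x‖ ^ 2 = 1) ∧
          (∀ n, ParallelSim.IsPiecewiseConstant (H n) ∧
            (∀ t, 0 ≤ t → ParallelSim.IsGeomLocal 2 b (H n t)) ∧
            ParallelSim.IsTimeOrderedExp (H n) (U n) ∧
            ParallelSim.IsSwapRouted G (C n) (s n) (T.eval n) (H n) (U n)) ∧
          ∀ p q r : Polynomial ℕ, p ≠ 0 → r ≠ 0 →
            ∀ᶠ n : ℕ in Filter.atTop,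
              ∀ t ∈ Set.Icc (0 : ℝ) (n * s n * T.eval n),
              ∀ ε ε' : ℝ, 0 ≤ ε → ε ≤ 1 - 1 / ((p.eval n : ℕ) : ℝ) →
                0 < ε' → ε' < 1 - ε - 1 / ((r.eval n : ℕ) : ℝ) →
              ∀ A : ParallelSim.Algorithm n, A.circuit.IsOver G →
                A.circuit.size ≤ q.eval (n + ⌈t⌉₊ + d ⌊t / (n * s n)⌋₊) →
                ParallelSim.Simulates A (U n t) ε →
                (d ⌊t / (n * s n)⌋₊ : ℝ) - c * (n * s n)
                    - MvPolynomial.eval ![Real.log n, Real.log (Real.log (1 / ε'))] P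
                  ≤ A.circuit.depth := by
  obtain ⟨b, m, B, hb, hm, hB, hgen⟩ := ParallelSim.exists_slot_generator hG
  refine ⟨b, m + 1, 0, fun s d X Xhat f T hf => ?_⟩
  obtain ⟨g, hgX, hgC, hfg⟩ := hf.iterated
  choose C hCG hCs hCg using hgC
  have hslots := fun n => ParallelSim.exists_slots harity (C n) (hCG n) (hCs n)
  choose v hv hprod using hslots
  have hlog := fun n j => hgen n (v n j) (hv n j)
  choose H hloc hbd using hlog
  have hexp : ∀ n, (fun j => NormedSpace.exp (-Complex.I • H n j)) = v n :=
    fun n => funext fun j => (hbd n j).1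
  have hC : ∀ n k, ∀ x ∈ Xhat n, ‖((C n).toOp ^ k) (f n k x) x‖ ^ 2 = 1 := by
    intro n k x hx
    rw [hfg n k x hx]
    exact (hCg n).norm_sq_pow_apply (hgX n) k (hf.subset n x hx)
  refine ⟨C, fun n => ParallelSim.slotHamiltonian (H n) (n * s n * T.eval n),
    fun n => ParallelSim.slotEvolution (H n) (n * s n * T.eval n),
    fun n => ⟨hCG n, hCs n, hC n⟩, fun n => ⟨ParallelSim.isPiecewiseConstant_slotHamiltonian,
      fun t _ => ?_, ParallelSim.isTimeOrderedExp_slotEvolution, fun j hj => ⟨fun t ht => ?_, ?_⟩,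
      fun t ht => ParallelSim.slotHamiltonian_eq_zero ht, fun k hk => ?_⟩, ?_⟩
  · dsimp only [ParallelSim.slotHamiltonian]
    split_ifs
    exacts [hloc n _, ParallelSim.isGeomLocal_zero hb]
  · dsimp only
    rw [ParallelSim.slotHamiltonian_eq hj ht,
      ParallelSim.slotHamiltonian_eq hj ⟨le_rfl, lt_add_one _⟩]
  · dsimp only
    rw [ParallelSim.slotHamiltonian_eq hj ⟨le_rfl, lt_add_one _⟩, (hbd n j).1]
    exact hv n j
  · obtain ⟨π, hπ⟩ := hprod n k
    refine ⟨π, ?_⟩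
    dsimp only
    rw [ParallelSim.slotEvolution_natCast (by rw [mul_comm]; exact Nat.mul_le_mul_left _ hk), hexp,
      hπ]
  · intro p q r hp _
    filter_upwards [ParallelSim.depth_le_of_isIteratedParallelHard hf T hm hB hv hloc hbd hprod hC
      hp q] with n hn t ht ε ε' _ hε _ _ A hA hsize hsim
    have h := hn t ht ε hε A hA hsize hsim
    have h' : (d ⌊t / (n * s n)⌋₊ : ℝ) ≤ A.circuit.depth + (m + 1) * (n * s n) := by
      exact_mod_cast h
    rw [map_zero]
    linarith
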